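/- **Setting.** Let $\mathcal D=\mathcal D(\mathbb R)$ be the complex test functions on $\mathbb R$ and $\mathcal D'=\mathcal D'(\mathbb R)$ the complex Schwartz distributions. For $\varphi\in\mathcal D$ let $R_\varphi=\sup\{|x|:\varphi(x)\neq0\}$ if $\varphi\ne0$, and $R_0=1$. For $n\ge1$ let $\mathcal D_n$ be the set of all $\varphi\in\mathcal D$ that are real-valued and even and satisfy $R_\varphi\le 1/n$, $\int\varphi=1$, $\int x^k\varphi(x)\,dx=0$ for $1\le k\le n$, $\int|\varphi|\le1+1/n$, and $\sup|\varphi^{(k)}|\le R_\varphi^{-2(k+1)}$ for $0\le k\le n$. Let $\mathcal U$ be an ultrafilter on $\mathcal D$ with $\mathcal D_n\in\mathcal U$ for all $n\ge1$; "a.e." means "for all $\varphi$ in some member of $\mathcal U$". A net $(f_\varphi)_{\varphi\in\mathcal D}$ in $C^\infty(\mathbb R,\mathbb C)$ is *moderate* if for every compact $K$ and every $k\ge 0$ there is $m\in\mathbb N$ with $\sup_K|f_\varphi^{(k)}|\le R_\varphi^{-m}$ a.e.; it is *negligible* if for every compact $K$ and all $k,p\ge 0$, $\sup_K|f_\varphi^{(k)}|\le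 R_\varphi^{p}$ a.e. Then $\widehat{\mathcal E(\mathbb R)}$ is the differential algebra of moderate nets modulo negligible nets, and $q(f_\varphi)$ is the class of $(f_\varphi)$. In the same way $\widehat{\mathbb C}$ is obtained from nets of complex numbers (moderate: $|a_\varphi|\le R_\varphi^{-m}$ a.e. for some $m$; negligible: $|a_\varphi|\le R_\varphi^{p}$ a.e. for all $p$); $\widehat{\mathcal E(\mathbb R)}$ is a $\widehat{\mathbb C}$-algebra. For $f=q(f_\varphi)$ put $f'=q(f_\varphi')$ and $f(0)=q(f_\varphi(0))\in\widehat{\mathbb C}$. For $x,y\in\widehat{\mathbb C}$, $x\approx y$ means $|x-y|<1/n$ for all $n\in\mathbb N$, $n\ge1$. The embedding is $\iota:\mathcal D'\to\widehat{\mathcal E(\mathbb R)}$, $\iota(T)=q(T\star\varphi)$; a smooth function $f$ is identified with $\iota(f)$. Let $\mathcal D'_+$ be the set of distributions supported in $[0,\infty)$, and $\widehat{\mathrm{span}}(\mathcal D'_+)$ the $\widehat{\mathbb C}$-linear span of $\iota(\mathcal D'_+)$. For $T\in\mathcal D'_+$ and $f=\sum_n\alpha_n\iota(T_n)$ with $\alpha_n\in\widehat{\mathbb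 C}$, $T_n\in\mathcal D'_+$, put $T\star f=\sum_n\alpha_n\,\iota(T\star T_n)$; this does not depend on the representation of $f$. Let $H$ be the Heaviside and $\delta$ the Dirac distribution. **Lemma (Steady-State Current).** Let $L,R,C\in\mathbb R$ with $L\ge0$, $R\ge0$, $C>0$, $L^2+R^2\ne0$, and let $V\in\widehat{\mathrm{span}}(\mathcal D'_+)$. Consider, for $I\in\widehat{\mathcal E(\mathbb R)}$, the problem $$(\ast)\qquad LI''+RI'+\tfrac1C I=V',\qquad I(0)=0,\qquad LI'(0)=0 .$$ (i) If $L=0$, then $(\ast)$ is equivalent to $RI'+\frac1CI=V'$, $I(0)=0$, and its unique solution in $\widehat{\mathcal E(\mathbb R)}$ is $$I(t)=(g\star V')(t)-(g\star V')(0)\,e^{-\frac{t}{RC}},\qquad g(t)=\tfrac1R H(t)e^{-\frac{t}{RC}} .$$ (ii) If $R^2-\frac{4L}{C}<0$, then $(\ast)$ is equivalent to $LI''+RI'+\frac1CI=V'$, $I(0)=I'(0)=0$. Put $\omega=\frac1{2L}\sqrt{\frac{4L}{C}-R^2}$ and $G(t)=\frac1{L\omega}H(t)e^{-\frac{R}{2L}t}\sin\omega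 t$. The unique solution of $(\ast)$ in $\widehat{\mathcal E(\mathbb R)}$ is $$I(t)=-(G\star V')(0)\,e^{-\frac{R}{2L}t}\cos\omega t-\frac{R\,(G\star V')(0)+2L\,(G'\star V')(0)}{2L\omega}\,e^{-\frac{R}{2L}t}\sin\omega t+(G\star V')(t).$$ Moreover $\iota(G)(0)\approx0$, $\iota(G')(0)\approx\frac1{2L}$, and in $\mathcal D'$ $$G'=-\tfrac{R}{2L}G+\tfrac1LH(t)e^{-\frac{R}{2L}t}\cos\omega t,$$ $$G''=\tfrac1L\delta-\tfrac RLG'-\tfrac1{LC}G=\tfrac1L\delta-\tfrac{R}{L^2}H(t)e^{-\frac{R}{2L}t}\cos\omega t+\tfrac1{L\omega}\Big(\tfrac{R^2}{4L^2}-\omega^2\Big)H(t)e^{-\frac{R}{2L}t}\sin\omega t .$$ (iii) If $R=0$ and $L>0$ (superconductivity), then $(\ast)$ is equivalent to $LI''+\frac1CI=V'$, $I(0)=I'(0)=0$. Put $\omega=\frac1{\sqrt{LC}}$ and $G_0(t)=\frac1\omega H(t)\sin\omega t$. The unique solution of $(\ast)$ in $\widehat{\mathcal E(\mathbb R)}$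 is $$I(t)=-\frac{(G_0\star V')(0)}{L}\cos\omega t-\frac{(G_0'\star V')(0)}{L\omega}\sin\omega t+\frac1L(G_0\star V')(t).$$ Moreover $\iota(G_0)(0)\approx0$, $\iota(G_0')(0)=\frac12$, and in $\mathcal D'$: $G_0'=H(t)\cos\omega t$ and $G_0''=\delta-\omega^2G_0=\delta-\omega H(t)\sin\omega t$. -/

import Mathlib

open TopologicalSpace MeasureTheory Filter Topology
open scoped Distributions ContDiff CompactConvergenceCLM LineDeriv

namespace SteadyState

section

/-- Complex-valued test functions on the real line. -/
abbrev TestFn : Type := 𝓓((⊤ : Opens ℝ), ℂ)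

/-- Complex-valued Schwartz distributions on the real line. -/
abbrev Dist : Type := 𝓓'((⊤ : Opens ℝ), ℂ)

/-- `f` is smooth with compact support. -/
def IsTest (f : ℝ → ℂ) : Prop := ContDiff ℝ ∞ f ∧ HasCompactSupport f

theorem IsTest.re {f : ℝ → ℂ} (h : IsTest f) :
    ContDiff ℝ ∞ (fun x => (f x).re) ∧ HasCompactSupport (fun x => (f x).re) :=
  ⟨Complex.reCLM.contDiff.comp h.1, h.2.comp_left (g := Complex.re) rfl⟩

theorem IsTest.im {f : ℝ → ℂ} (h : IsTest f) :
    ContDiff ℝ ∞ (fun x => (f x).im) ∧ HasCompactSupport (fun x => (f x).im) :=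
  ⟨Complex.imCLM.contDiff.comp h.1, h.2.comp_left (g := Complex.im) rfl⟩

open Classical in
/-- The `ℂ`-linear pairing `⟨T, f⟩ = ⟨T, Re f⟩ + i ⟨T, Im f⟩` of a distribution with a
complex-valued test function (and `0` if `f` is not a test function). -/
noncomputable def pair (T : Dist) (f : ℝ → ℂ) : ℂ :=
  if h : IsTest f then
    T ⟨fun x => (f x).re, h.re.1, h.re.2, Set.subset_univ _⟩ +
      Complex.I * T ⟨fun x => (f x).im, h.im.1, h.im.2, Set.subset_univ _⟩
  else 0

theorem IsTest.add {f g : ℝ → ℂ} (hf : IsTest f) (hg : IsTest g) : IsTest (fun x => f x + g x) :=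
  ⟨hf.1.add hg.1, hf.2.add hg.2⟩

theorem IsTest.const_mul {f : ℝ → ℂ} (c : ℂ) (hf : IsTest f) : IsTest (fun x => c * f x) :=
  ⟨contDiff_const.mul hf.1, hf.2.mul_left (f := fun _ => c)⟩

theorem pair_add (T : Dist) {f g : ℝ → ℂ} (hf : IsTest f) (hg : IsTest g) :
    pair T (fun x => f x + g x) = pair T f + pair T g := by
  rw [pair, pair, pair, dif_pos hf, dif_pos hg, dif_pos (hf.add hg)]
  have e1 : (⟨fun x => (f x + g x).re, (hf.add hg).re.1, (hf.add hg).re.2, Set.subset_univ _⟩ :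
      𝓓((⊤ : Opens ℝ), ℝ)) = ⟨fun x => (f x).re, hf.re.1, hf.re.2, Set.subset_univ _⟩ +
      ⟨fun x => (g x).re, hg.re.1, hg.re.2, Set.subset_univ _⟩ := by ext x; rfl
  have e2 : (⟨fun x => (f x + g x).im, (hf.add hg).im.1, (hf.add hg).im.2, Set.subset_univ _⟩ :
      𝓓((⊤ : Opens ℝ), ℝ)) = ⟨fun x => (f x).im, hf.im.1, hf.im.2, Set.subset_univ _⟩ +
      ⟨fun x => (g x).im, hg.im.1, hg.im.2, Set.subset_univ _⟩ := by ext x; rfl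
  rw [e1, e2, map_add, map_add]; ring

theorem pair_const_mul (T : Dist) {f : ℝ → ℂ} (c : ℂ) (hf : IsTest f) :
    pair T (fun x => c * f x) = c * pair T f := by
  rw [pair, pair, dif_pos hf, dif_pos (hf.const_mul c)]
  have e1 : (⟨fun x => (c * f x).re, (hf.const_mul c).re.1, (hf.const_mul c).re.2,
      Set.subset_univ _⟩ : 𝓓((⊤ : Opens ℝ), ℝ)) =
      c.re • ⟨fun x => (f x).re, hf.re.1, hf.re.2, Set.subset_univ _⟩ -
      c.im • ⟨fun x => (f x).im, hf.im.1, hf.im.2, Set.subset_univ _⟩ := by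
    ext x; exact Complex.mul_re _ _
  have e2 : (⟨fun x => (c * f x).im, (hf.const_mul c).im.1, (hf.const_mul c).im.2,
      Set.subset_univ _⟩ : 𝓓((⊤ : Opens ℝ), ℝ)) =
      c.re • ⟨fun x => (f x).im, hf.im.1, hf.im.2, Set.subset_univ _⟩ +
      c.im • ⟨fun x => (f x).re, hf.re.1, hf.re.2, Set.subset_univ _⟩ := by
    ext x; exact Complex.mul_im _ _
  rw [e1, e2, map_add, map_sub, map_smul, map_smul, map_smul, map_smul]
  simp only [Complex.real_smul]
  conv_rhs => rw [← Complex.re_add_im c]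
  linear_combination -(c.im : ℂ) * T ⟨fun x => (f x).im, hf.im.1, hf.im.2, Set.subset_univ _⟩ *
    Complex.I_mul_I

/-- Continuity estimate for a distribution on test functions supported in a fixed compact set. -/
theorem pair_bound_real (T : Dist) (K : Compacts ℝ) : ∃ C : ℝ, 0 ≤ C ∧ ∃ N : ℕ,
    ∀ f : 𝓓((⊤ : Opens ℝ), ℝ), Function.support f ⊆ K → ∀ M : ℝ, 0 ≤ M →
      (∀ i ≤ N, ∀ x ∈ K, ‖iteratedDeriv i f x‖ ≤ M) → ‖T f‖ ≤ C * M := by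
  let A : 𝓓_{K}(ℝ, ℝ) →L[ℝ] ℂ :=
    (T : 𝓓((⊤ : Opens ℝ), ℝ) →L[ℝ] ℂ).comp
      (TestFunction.ofSupportedInCLM ℝ (Set.subset_univ (K : Set ℝ)))
  let q : Seminorm ℝ 𝓓_{K}(ℝ, ℝ) := (normSeminorm ℝ ℂ).comp A.toLinearMap
  have hq : Continuous q := by
    change Continuous fun f => ‖A f‖
    exact continuous_norm.comp A.continuous
  obtain ⟨s, C, -, hC⟩ := Seminorm.bound_of_continuous
    (ContDiffMapSupportedIn.withSeminorms ℝ ℝ ℝ ⊤ K) q hq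
  refine ⟨C, C.2, s.sup id, fun f hf M hM h => ?_⟩
  let f' : 𝓓_{K}(ℝ, ℝ) := .of_support_subset f.contDiff hf
  have e : T f = A f' := rfl
  rw [e]
  refine (hC f').trans ?_
  change (C : ℝ) * _ ≤ _
  refine mul_le_mul_of_nonneg_left ?_ C.2
  refine Seminorm.finset_sup_apply_le hM fun i hi => ?_
  rw [ContDiffMapSupportedIn.seminorm_top_le_iff ℝ hM]
  intro x hx
  rw [norm_iteratedFDeriv_eq_norm_iteratedDeriv]
  exact h i (Finset.le_sup (f := id) hi) x hx

theorem pair_bound (T : Dist) (K : Compacts ℝ) : ∃ C : ℝ, 0 ≤ C ∧ ∃ N : ℕ,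
    ∀ f : ℝ → ℂ, ContDiff ℝ ∞ f → Function.support f ⊆ K → ∀ M : ℝ, 0 ≤ M →
      (∀ i ≤ N, ∀ x ∈ K, ‖iteratedDeriv i f x‖ ≤ M) → ‖pair T f‖ ≤ C * M := by
  obtain ⟨C, hC, N, h⟩ := pair_bound_real T K
  refine ⟨C + C, by positivity, N, fun f hf hs M hM hi => ?_⟩
  have hT : IsTest f := ⟨hf, HasCompactSupport.intro K.isCompact
    (fun x hx => by by_contra h0; exact hx (hs h0))⟩
  have key : ∀ (l : ℂ →L[ℝ] ℝ), ‖l‖ ≤ 1 → ∀ i ≤ N, ∀ x ∈ K,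
      ‖iteratedDeriv i (fun y => l (f y)) x‖ ≤ M := by
    intro l hl i hiN x hx
    have := l.norm_iteratedFDeriv_comp_left (f := f) (x := x) (N := ∞) (n := i)
      hf.contDiffAt (by exact_mod_cast le_top)
    rw [norm_iteratedFDeriv_eq_norm_iteratedDeriv, norm_iteratedFDeriv_eq_norm_iteratedDeriv]
      at this
    refine this.trans ?_
    calc ‖l‖ * _ ≤ 1 * ‖iteratedDeriv i f x‖ := by gcongr
      _ ≤ M := by rw [one_mul]; exact hi i hiN x hx
  rw [pair, dif_pos hT]
  refine (norm_add_le _ _).trans ?_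
  rw [norm_mul, Complex.norm_I, one_mul, add_mul]
  refine add_le_add (h _ ?_ M hM ?_) (h _ ?_ M hM ?_)
  · intro x hx; exact hs (fun h0 => hx (by simp [h0]))
  · exact key Complex.reCLM (by simp)
  · intro x hx; exact hs (fun h0 => hx (by simp [h0]))
  · exact key Complex.imCLM (by simp)

theorem mul_bound {η : ℝ → ℂ} (hη : ContDiff ℝ ∞ η) (K : Compacts ℝ) (N : ℕ) :
    ∃ C : ℝ, 0 ≤ C ∧ ∀ g : ℝ → ℂ, ContDiff ℝ ∞ g → ∀ M : ℝ, 0 ≤ M → ∀ x ∈ K,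
      (∀ i ≤ N, ‖iteratedDeriv i g x‖ ≤ M) →
      ∀ i ≤ N, ‖iteratedDeriv i (fun y => η y * g y) x‖ ≤ C * M := by
  have hb : ∀ i : ℕ, ∃ B : ℝ, ∀ x ∈ (K : Set ℝ), ‖iteratedDeriv i η x‖ ≤ B := fun i =>
    K.isCompact.exists_bound_of_continuousOn
      (hη.continuous_iteratedDeriv i (by exact_mod_cast le_top)).continuousOn
  choose B hB using hb
  have hB0 : ∀ i, 0 ≤ |B i| := fun i => abs_nonneg _
  refine ⟨∑ n ∈ Finset.range (N + 1), ∑ i ∈ Finset.range (n + 1), (n.choose i : ℝ) * |B i|,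
    by positivity, fun g hg M hM x hx h n hn => ?_⟩
  have := norm_iteratedFDeriv_mul_le (𝕜 := ℝ) (N := ∞) hη hg x (n := n) (by exact_mod_cast le_top)
  simp only [norm_iteratedFDeriv_eq_norm_iteratedDeriv] at this
  refine this.trans ?_
  calc _ ≤ ∑ i ∈ Finset.range (n + 1), (n.choose i : ℝ) * |B i| * M := by
        refine Finset.sum_le_sum fun i hi => ?_
        gcongr
        · exact (hB i x hx).trans (le_abs_self _)
        · exact h _ ((Nat.sub_le _ _).trans hn)
    _ = (∑ i ∈ Finset.range (n + 1), (n.choose i : ℝ) * |B i|) * M := by rw [Finset.sum_mul]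
    _ ≤ _ := by
        gcongr
        exact Finset.single_le_sum
          (f := fun n => ∑ i ∈ Finset.range (n + 1), (n.choose i : ℝ) * |B i|)
          (fun n _ => by positivity) (Finset.mem_range.2 (Nat.lt_succ_of_le hn))

theorem pair_mul_bound (T : Dist) {η : ℝ → ℂ} (hη : ContDiff ℝ ∞ η) (K : Compacts ℝ) :
    ∃ C : ℝ, 0 ≤ C ∧ ∃ N : ℕ,
    ∀ g : ℝ → ℂ, ContDiff ℝ ∞ g → (∀ x ∉ K, η x * g x = 0) → ∀ M : ℝ, 0 ≤ M →
      (∀ i ≤ N, ∀ x ∈ K, ‖iteratedDeriv i g x‖ ≤ M) →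
      ‖pair T (fun x => η x * g x)‖ ≤ C * M := by
  obtain ⟨C, hC, N, h⟩ := pair_bound T K
  obtain ⟨C', hC', h'⟩ := mul_bound hη K N
  refine ⟨C * C', by positivity, N, fun g hg hs M hM hi => ?_⟩
  rw [mul_assoc]
  exact h _ (hη.mul hg) (fun x hx => by by_contra h0; exact hx (hs x h0)) _ (by positivity)
    (fun i hiN x hx => h' g hg M hM x hx (fun j hj => hi j hj x hx) i hiN)

end

section

theorem IsTest.deriv {f : ℝ → ℂ} (h : IsTest f) : IsTest (deriv f) :=
  ⟨(contDiff_infty_iff_deriv.1 h.1).2, h.2.deriv⟩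

theorem IsTest.iteratedDeriv {f : ℝ → ℂ} (h : IsTest f) (n : ℕ) : IsTest (iteratedDeriv n f) := by
  induction n with
  | zero => simpa using h
  | succ n ih => rw [iteratedDeriv_succ]; exact ih.deriv

theorem IsTest.comp_add {f : ℝ → ℂ} (h : IsTest f) (a : ℝ) : IsTest (fun z => f (z + a)) :=
  ⟨h.1.comp (contDiff_id.add contDiff_const), h.2.comp_homeomorph (Homeomorph.addRight a)⟩

theorem IsTest.bound {f : ℝ → ℂ} (h : IsTest f) : ∃ M : ℝ, 0 ≤ M ∧ ∀ x, ‖f x‖ ≤ M := by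
  obtain ⟨M, hM⟩ := h.2.exists_bound_of_continuous h.1.continuous
  exact ⟨M, (norm_nonneg _).trans (hM 0), hM⟩

theorem IsTest.bound_iteratedDeriv {f : ℝ → ℂ} (h : IsTest f) (N : ℕ) :
    ∃ M : ℝ, 0 ≤ M ∧ ∀ i ≤ N, ∀ x, ‖_root_.iteratedDeriv i f x‖ ≤ M := by
  choose B hB0 hB using fun i => (h.iteratedDeriv i).bound
  refine ⟨∑ i ∈ Finset.range (N + 1), B i, Finset.sum_nonneg fun i _ => hB0 i, fun i hi x => ?_⟩
  exact (hB i x).trans (Finset.single_le_sum (fun i _ => hB0 i)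
    (Finset.mem_range.2 (Nat.lt_succ_of_le hi)))

theorem IsTest.exists_radius {f : ℝ → ℂ} (h : IsTest f) :
    ∃ A : ℝ, 0 ≤ A ∧ ∀ x, A < |x| → f x = 0 := by
  obtain ⟨A, hA⟩ := h.2.isCompact.isBounded.subset_closedBall 0
  refine ⟨max A 0, le_max_right _ _, fun x hx => ?_⟩
  by_contra h0
  have := hA (subset_closure h0)
  rw [mem_closedBall_zero_iff, Real.norm_eq_abs] at this
  exact absurd (this.trans (le_max_left _ _)) (not_le.2 hx)

/-- The function `x ↦ ⟨T(y), η(y) f(x + σ y)⟩`. -/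
noncomputable def kern (T : Dist) (η : ℝ → ℂ) (σ : ℝ) (f : ℝ → ℂ) (x : ℝ) : ℂ :=
  pair T (fun y => η y * f (x + σ * y))

section kern

variable {T : Dist} {η : ℝ → ℂ} {σ : ℝ}

theorem isTest_kern (hη : ContDiff ℝ ∞ η) (hσ : |σ| = 1) {f : ℝ → ℂ} (hf : IsTest f) (x : ℝ) :
    IsTest (fun y => η y * f (x + σ * y)) := by
  refine ⟨hη.mul (hf.1.comp (contDiff_const.add (contDiff_const.mul contDiff_id))), ?_⟩
  obtain ⟨A, hA, hA'⟩ := hf.exists_radius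
  refine HasCompactSupport.intro (isCompact_closedBall (0 : ℝ) (A + |x|)) fun y hy => ?_
  rw [mem_closedBall_zero_iff, Real.norm_eq_abs, not_le] at hy
  rw [hA', mul_zero]
  have h1 : |σ * y| = |y| := by rw [abs_mul, hσ, one_mul]
  have h2 : |σ * y| ≤ |x + σ * y| + |x| := by
    have := abs_sub (x + σ * y) x
    rwa [add_sub_cancel_left] at this
  linarith

theorem kern_add (hη : ContDiff ℝ ∞ η) (hσ : |σ| = 1) {f g : ℝ → ℂ} (hf : IsTest f)
    (hg : IsTest g) (x : ℝ) :
    kern T η σ (fun z => f z + g z) x = kern T η σ f x + kern T η σ g x := by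
  simp only [kern]
  rw [← pair_add T (isTest_kern hη hσ hf x) (isTest_kern hη hσ hg x)]
  simp only [mul_add]

theorem kern_const_mul (hη : ContDiff ℝ ∞ η) (hσ : |σ| = 1) (c : ℂ) {f : ℝ → ℂ} (hf : IsTest f)
    (x : ℝ) : kern T η σ (fun z => c * f z) x = c * kern T η σ f x := by
  simp only [kern]
  rw [← pair_const_mul T c (isTest_kern hη hσ hf x)]
  congr 1; ext y; ring

theorem iteratedDeriv_comp_affine {f : ℝ → ℂ} (hf : ContDiff ℝ ∞ f) (x σ y : ℝ) (i : ℕ) :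
    iteratedDeriv i (fun y => f (x + σ * y)) y = (σ : ℂ) ^ i * iteratedDeriv i f (x + σ * y) := by
  have := congrFun (iteratedDeriv_comp_const_smul (n := i) (f := fun z => f (x + z))
    ((hf.comp (contDiff_const.add contDiff_id)).of_le (by exact_mod_cast le_top)) σ) y
  rw [this, iteratedDeriv_comp_const_add]
  simp [Complex.real_smul]

theorem kern_bound (T : Dist) (hη : ContDiff ℝ ∞ η) (hσ : |σ| = 1) (A X : ℝ) :
    ∃ C : ℝ, 0 ≤ C ∧ ∃ N : ℕ, ∀ f : ℝ → ℂ, ContDiff ℝ ∞ f → (∀ z, A < |z| → f z = 0) →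
      ∀ x : ℝ, |x| ≤ X → ∀ M : ℝ, 0 ≤ M → (∀ i ≤ N, ∀ z, ‖iteratedDeriv i f z‖ ≤ M) →
      ‖kern T η σ f x‖ ≤ C * M := by
  obtain ⟨C, hC, N, h⟩ := pair_mul_bound T hη ⟨Metric.closedBall 0 (A + X), isCompact_closedBall _ _⟩
  refine ⟨C, hC, N, fun f hf hA x hx M hM hi => ?_⟩
  refine h _ (hf.comp (contDiff_const.add (contDiff_const.mul contDiff_id))) ?_ M hM ?_
  · intro y hy
    change y ∉ Metric.closedBall 0 (A + X) at hy
    rw [mem_closedBall_zero_iff, Real.norm_eq_abs, not_le] at hy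
    simp only [Function.comp]
    rw [hA, mul_zero]
    have h1 : |σ * y| = |y| := by rw [abs_mul, hσ, one_mul]
    have h2 : |σ * y| ≤ |x + σ * y| + |x| := by
      have := abs_sub (x + σ * y) x
      rwa [add_sub_cancel_left] at this
    simp only [id]
    linarith
  · intro i hiN y _
    have := iteratedDeriv_comp_affine hf x σ y i
    simp only [Function.comp_def, id]
    rw [this, norm_mul, norm_pow, Complex.norm_real, Real.norm_eq_abs, hσ, one_pow, one_mul]
    exact hi i hiN _

theorem taylor_bound {f : ℝ → ℂ} (hf : ContDiff ℝ ∞ f) {M : ℝ}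
    (hM : ∀ x, ‖deriv (deriv f) x‖ ≤ M) (z h : ℝ) :
    ‖f (z + h) - f z - h * deriv f z‖ ≤ M * |h| * |h| := by
  have hd : Differentiable ℝ f := (contDiff_infty_iff_deriv.1 hf).1
  have hf1 := (contDiff_infty_iff_deriv.1 hf).2
  have hd1 : Differentiable ℝ (deriv f) := (contDiff_infty_iff_deriv.1 hf1).1
  have h1 : ∀ a b : ℝ, ‖deriv f b - deriv f a‖ ≤ M * |b - a| := fun a b =>
    Convex.norm_image_sub_le_of_norm_deriv_le (s := Set.univ) (f := deriv f)
      (fun x _ => hd1 x) (fun x _ => hM x) convex_univ (Set.mem_univ a) (Set.mem_univ b)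
  have hu : ∀ t : ℝ, HasDerivAt (fun t : ℝ => f (z + t) - (t : ℂ) * deriv f z)
      (deriv f (z + t) - deriv f z) t := by
    intro t
    have a1 : HasDerivAt (fun t : ℝ => f (z + t)) (deriv f (z + t)) t := by
      simpa using ((hd (z + t)).hasDerivAt).comp_const_add z t
    have a2 : HasDerivAt (fun t : ℝ => (t : ℂ) * deriv f z) (1 * deriv f z) t :=
      (Complex.ofRealCLM.hasDerivAt (x := t)).mul_const _
    have a3 := a1.sub a2
    rw [one_mul] at a3
    exact a3
  have := Convex.norm_image_sub_le_of_norm_hasDerivWithin_le (C := M * |h|)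
    (s := Metric.closedBall (0 : ℝ) |h|) (fun t _ => (hu t).hasDerivWithinAt) (fun t ht => ?_)
    (convex_closedBall 0 |h|) (x := 0) (y := h) (by simp) (by simp)
  · simp only [add_zero, Complex.ofReal_zero, zero_mul, sub_zero, Real.norm_eq_abs] at this
    rw [sub_right_comm]
    exact this
  · rw [mem_closedBall_zero_iff, Real.norm_eq_abs] at ht
    have hM0 : 0 ≤ M := (norm_nonneg _).trans (hM 0)
    refine (h1 z (z + t)).trans ?_
    rw [add_sub_cancel_left]
    gcongr

theorem hasDerivAt_kern (hη : ContDiff ℝ ∞ η) (hσ : |σ| = 1) {f : ℝ → ℂ} (hf : IsTest f) (x : ℝ) :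
    HasDerivAt (kern T η σ f) (kern T η σ (deriv f) x) x := by
  obtain ⟨A, hA, hA'⟩ := hf.exists_radius
  obtain ⟨C, hC, N, hb⟩ := kern_bound T hη hσ (A + 1) |x|
  obtain ⟨M, hM0, hM⟩ := hf.bound_iteratedDeriv (N + 2)
  have hA2 : ∀ z, A < |z| → deriv f z = 0 := by
    intro z hz
    have : f =ᶠ[𝓝 z] fun _ => 0 := by
      filter_upwards [(isOpen_lt continuous_const continuous_abs).mem_nhds hz] with w hw
      exact hA' w hw
    rw [this.deriv_eq]; simp
  have key : ∀ h : ℝ, |h| ≤ 1 →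
      ‖kern T η σ f (x + h) - kern T η σ f x - h * kern T η σ (deriv f) x‖ ≤
        C * (M * |h| * |h|) := by
    intro h hh
    have e : kern T η σ f (x + h) - kern T η σ f x - h * kern T η σ (deriv f) x =
        kern T η σ (fun z => f (z + h) + ((-1) * f z + (-(h : ℂ)) * deriv f z)) x := by
      rw [kern_add hη hσ (hf.comp_add h) ((hf.const_mul _).add (hf.deriv.const_mul _)),
        kern_add hη hσ (hf.const_mul _) (hf.deriv.const_mul _),
        kern_const_mul hη hσ _ hf, kern_const_mul hη hσ _ hf.deriv]
      have : kern T η σ (fun z => f (z + h)) x = kern T η σ f (x + h) := by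
        simp only [kern]
        congr 1; ext y; congr 2; ring
      rw [this]; ring
    rw [e]
    have ht : IsTest (fun z => f (z + h) + ((-1) * f z + (-(h : ℂ)) * deriv f z)) :=
      (hf.comp_add h).add ((hf.const_mul _).add (hf.deriv.const_mul _))
    refine hb _ ht.1 ?_ x le_rfl _ (by positivity) ?_
    · intro z hz
      have h1 : A < |z| := by linarith
      have h2 : A < |z + h| := by
        have := abs_sub (z + h) h
        rw [add_sub_cancel_right] at this
        linarith
      rw [hA' _ h1, hA' _ h2, hA2 _ h1]; simp
    · intro i hi z
      have c1 : ContDiff ℝ i (fun z => f (z + h)) :=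
        (hf.comp_add h).1.of_le (by exact_mod_cast le_top)
      have c2 : ContDiff ℝ i f := hf.1.of_le (by exact_mod_cast le_top)
      have c3 : ContDiff ℝ i (deriv f) := hf.deriv.1.of_le (by exact_mod_cast le_top)
      have e2 : iteratedDeriv i (fun z => f (z + h) + ((-1) * f z + (-(h : ℂ)) * deriv f z)) z =
          iteratedDeriv i f (z + h) - iteratedDeriv i f z - h * deriv (iteratedDeriv i f) z := by
        rw [iteratedDeriv_fun_add c1.contDiffAt
          ((contDiff_const.mul c2).add (contDiff_const.mul c3)).contDiffAt,
          iteratedDeriv_fun_add (contDiff_const.mul c2).contDiffAt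
          (contDiff_const.mul c3).contDiffAt, iteratedDeriv_const_mul_field,
          iteratedDeriv_const_mul_field, iteratedDeriv_comp_add_const, ← iteratedDeriv_succ',
          iteratedDeriv_succ]
        ring
      rw [e2]
      refine taylor_bound (hf.iteratedDeriv i).1 (fun w => ?_) z h
      rw [← iteratedDeriv_succ, ← iteratedDeriv_succ]
      exact hM _ (by omega) w
  rw [hasDerivAt_iff_isLittleO_nhds_zero]
  have : (fun h : ℝ => kern T η σ f (x + h) - kern T η σ f x - h • kern T η σ (deriv f) x)
      =O[𝓝 0] (fun h : ℝ => h * h) := by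
    refine Asymptotics.IsBigO.of_bound (C * M) ?_
    filter_upwards [Metric.closedBall_mem_nhds (0 : ℝ) one_pos] with h hh
    rw [mem_closedBall_zero_iff, Real.norm_eq_abs] at hh
    have := key h hh
    rw [Complex.real_smul, norm_mul, Real.norm_eq_abs]
    linarith
  refine this.trans_isLittleO ?_
  have h2 : (fun h : ℝ => h * h) =o[𝓝 0] (fun h : ℝ => h * 1) := by
    refine (Asymptotics.isBigO_refl (fun h : ℝ => h) _).mul_isLittleO ?_
    rw [Asymptotics.isLittleO_one_iff]
    exact tendsto_id
  simpa using h2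

theorem iteratedDeriv_kern (hη : ContDiff ℝ ∞ η) (hσ : |σ| = 1) {f : ℝ → ℂ} (hf : IsTest f)
    (n : ℕ) : iteratedDeriv n (kern T η σ f) = kern T η σ (iteratedDeriv n f) := by
  induction n with
  | zero => simp
  | succ n ih =>
    rw [iteratedDeriv_succ, ih, iteratedDeriv_succ]
    ext x
    exact (hasDerivAt_kern hη hσ (hf.iteratedDeriv n) x).deriv

theorem contDiff_kern (hη : ContDiff ℝ ∞ η) (hσ : |σ| = 1) {f : ℝ → ℂ} (hf : IsTest f) :
    ContDiff ℝ ∞ (kern T η σ f) := by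
  refine contDiff_of_differentiable_iteratedDeriv (n := ⊤) fun m _ => ?_
  rw [iteratedDeriv_kern hη hσ hf]
  exact fun x => (hasDerivAt_kern hη hσ (hf.iteratedDeriv m) x).differentiableAt

end kern

end

section

theorem isTest_coe (φ : TestFn) : IsTest φ := ⟨φ.contDiff, φ.hasCompactSupport⟩

/-! ### Convolution -/

/-- The regularization `(T ⋆ φ)(x) = ⟨T(y), φ(x - y)⟩`. -/
noncomputable def reg (T : Dist) (φ : TestFn) (x : ℝ) : ℂ :=
  pair T (fun y => φ (x - y))

theorem reg_eq_kern (T : Dist) (φ : TestFn) : reg T φ = kern T (fun _ => 1) (-1) φ := by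
  ext x
  simp only [reg, kern, one_mul, neg_one_mul, sub_eq_add_neg]

/-- A smooth cut-off, equal to `1` on `[-1, ∞)` and to `0` on `(-∞, -2]`. -/
noncomputable def cutoff (x : ℝ) : ℂ := (Real.smoothTransition (x + 2) : ℂ)

theorem contDiff_cutoff : ContDiff ℝ ∞ cutoff :=
  Complex.ofRealCLM.contDiff.comp
    (Real.smoothTransition.contDiff.comp (contDiff_id.add contDiff_const))

theorem cutoff_eq_zero {x : ℝ} (h : x ≤ -2) : cutoff x = 0 := by
  rw [cutoff, Real.smoothTransition.zero_of_nonpos (by linarith), Complex.ofReal_zero]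

theorem cutoff_eq_one {x : ℝ} (h : -1 ≤ x) : cutoff x = 1 := by
  rw [cutoff, Real.smoothTransition.one_of_one_le (by linarith), Complex.ofReal_one]

/-- `⟨T(x), η(x) ⟨S(y), η(y) f(x + y)⟩⟩` with the cut-off `η`. -/
noncomputable def convPair (T S : Dist) (f : ℝ → ℂ) : ℂ :=
  pair T (fun x => cutoff x * pair S (fun y => cutoff y * f (x + y)))

theorem convPair_eq (T S : Dist) (f : ℝ → ℂ) :
    convPair T S f = pair T (fun x => cutoff x * kern S cutoff 1 f x) := by
  simp only [convPair, kern, one_mul]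

theorem pair_zero (T : Dist) : pair T (fun _ => 0) = 0 := by
  have h : IsTest (fun _ => 0) := ⟨contDiff_const, HasCompactSupport.zero⟩
  have := pair_const_mul T 0 h
  simpa using this

theorem cutoff_kern_eq_zero (S : Dist) {f : ℝ → ℂ} {A : ℝ} (hA0 : 0 ≤ A)
    (hA : ∀ z, A < |z| → f z = 0) (x : ℝ) (hx : A + 2 < |x|) :
    cutoff x * kern S cutoff 1 f x = 0 := by
  rcases le_or_gt x 0 with h0 | h0
  · rw [abs_of_nonpos h0] at hx
    rw [cutoff_eq_zero (by linarith), zero_mul]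
  · rw [abs_of_pos h0] at hx
    have : (fun y => cutoff y * f (x + 1 * y)) = fun _ => 0 := by
      ext y
      rcases le_or_gt y (-2) with hy | hy
      · rw [cutoff_eq_zero hy, zero_mul]
      · rw [hA, mul_zero]
        rw [one_mul]
        exact lt_of_lt_of_le (by linarith) (le_abs_self _)
    rw [kern, this, pair_zero, mul_zero]

theorem isTest_cutoff_kern (S : Dist) {f : ℝ → ℂ} (hf : IsTest f) :
    IsTest (fun x => cutoff x * kern S cutoff 1 f x) := by
  obtain ⟨A, hA0, hA⟩ := hf.exists_radius
  refine ⟨contDiff_cutoff.mul (contDiff_kern contDiff_cutoff (by simp) hf), ?_⟩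
  refine HasCompactSupport.intro (isCompact_closedBall (0 : ℝ) (A + 2)) fun y hy => ?_
  rw [mem_closedBall_zero_iff, Real.norm_eq_abs, not_le] at hy
  exact cutoff_kern_eq_zero S hA0 hA y hy

theorem convPair_add (T S : Dist) {f g : ℝ → ℂ} (hf : IsTest f) (hg : IsTest g) :
    convPair T S (fun x => f x + g x) = convPair T S f + convPair T S g := by
  rw [convPair_eq, convPair_eq, convPair_eq,
    ← pair_add T (isTest_cutoff_kern S hf) (isTest_cutoff_kern S hg)]
  simp only [kern_add contDiff_cutoff (σ := 1) (by simp) hf hg, mul_add]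

theorem convPair_const_mul (T S : Dist) (c : ℂ) {f : ℝ → ℂ} (hf : IsTest f) :
    convPair T S (fun x => c * f x) = c * convPair T S f := by
  rw [convPair_eq, convPair_eq, ← pair_const_mul T c (isTest_cutoff_kern S hf)]
  simp only [kern_const_mul contDiff_cutoff (σ := 1) (by simp) c hf]
  congr 1; ext x; ring

theorem convPair_bound (T S : Dist) (A : ℝ) (hA0 : 0 ≤ A) : ∃ C : ℝ, 0 ≤ C ∧ ∃ N : ℕ,
    ∀ f : ℝ → ℂ, IsTest f → (∀ z, A < |z| → f z = 0) → ∀ M : ℝ, 0 ≤ M →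
      (∀ i ≤ N, ∀ z, ‖iteratedDeriv i f z‖ ≤ M) → ‖convPair T S f‖ ≤ C * M := by
  obtain ⟨C1, hC1, N1, h1⟩ := pair_mul_bound T contDiff_cutoff
    ⟨Metric.closedBall 0 (A + 2), isCompact_closedBall _ _⟩
  obtain ⟨C2, hC2, N2, h2⟩ := kern_bound (σ := 1) S contDiff_cutoff (by simp) A (A + 2)
  refine ⟨C1 * C2, by positivity, N1 + N2, fun f hf hA M hM hi => ?_⟩
  rw [convPair_eq, mul_assoc]
  refine h1 _ (contDiff_kern contDiff_cutoff (by simp) hf) ?_ _ (by positivity) ?_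
  · intro x hx
    change x ∉ Metric.closedBall 0 (A + 2) at hx
    rw [mem_closedBall_zero_iff, Real.norm_eq_abs, not_le] at hx
    exact cutoff_kern_eq_zero S hA0 hA x hx
  · intro i hiN x hx
    change x ∈ Metric.closedBall 0 (A + 2) at hx
    rw [mem_closedBall_zero_iff, Real.norm_eq_abs] at hx
    rw [iteratedDeriv_kern contDiff_cutoff (by simp) hf]
    refine h2 _ (hf.iteratedDeriv i).1 ?_ x hx M hM ?_
    · intro z hz
      have : f =ᶠ[𝓝 z] fun _ => 0 := by
        filter_upwards [(isOpen_lt continuous_const continuous_abs).mem_nhds hz] with w hw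
        exact hA w hw
      rw [this.iteratedDeriv_eq]
      simp
    · intro j hj z
      have : iteratedDeriv j (iteratedDeriv i f) = iteratedDeriv (j + i) f := by
        rw [iteratedDeriv_eq_iterate, iteratedDeriv_eq_iterate, iteratedDeriv_eq_iterate,
          Function.iterate_add_apply]
      rw [this]
      exact hi _ (by omega) z

theorem isTest_ofReal (f : 𝓓((⊤ : Opens ℝ), ℝ)) : IsTest (fun x => (f x : ℂ)) :=
  ⟨Complex.ofRealCLM.contDiff.comp f.contDiff,
    f.hasCompactSupport.comp_left (g := Complex.ofReal) rfl⟩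

/-- The convolution of two distributions, by the formula
`⟨T ⋆ S, f⟩ = ⟨T(x), η(x) ⟨S(y), η(y) f(x + y)⟩⟩`, where `η` is smooth, equal to `1` near `[0, ∞)`,
and vanishes near `-∞`. It is the usual convolution product when `T` and `S` are supported in
`[0, ∞)`, and it is only used for such distributions. -/
noncomputable def conv (T S : Dist) : Dist :=
  TestFunction.mkCLM ℝ (fun f : 𝓓((⊤ : Opens ℝ), ℝ) => convPair T S (fun x => (f x : ℂ)))
    (fun f g => by
      rw [← convPair_add T S (isTest_ofReal f) (isTest_ofReal g)]
      congr 1; ext x; exact Complex.ofReal_add _ _)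
    (fun c f => by
      rw [Complex.real_smul, ← convPair_const_mul T S c (isTest_ofReal f)]
      congr 1; ext x; exact Complex.ofReal_mul _ _)
    (fun K hK => by
      obtain ⟨A, hA⟩ := K.isCompact.isBounded.subset_closedBall 0
      obtain ⟨C, hC, N, h⟩ := convPair_bound T S (max A 0) (le_max_right _ _)
      have hT : ∀ f : 𝓓_{K}(ℝ, ℝ), IsTest (fun x => (f x : ℂ)) := fun f =>
        isTest_ofReal (TestFunction.ofSupportedIn hK f)
      refine (ContDiffMapSupportedIn.mkCLMtoNormedSpace (𝕜 := ℝ)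
        (fun f : 𝓓_{K}(ℝ, ℝ) => convPair T S (fun x => (f x : ℂ))) (fun f g => ?_) (fun c f => ?_)
        ⟨Finset.range (N + 1), C, hC, fun f => ?_⟩).continuous
      · rw [← convPair_add T S (hT f) (hT g)]
        congr 1; ext x; exact Complex.ofReal_add _ _
      · rw [Complex.real_smul,
          ← convPair_const_mul T S c (hT f)]
        congr 1; ext x; exact Complex.ofReal_mul _ _
      · refine h _ (hT f) ?_ _ (apply_nonneg _ _) ?_
        · intro z hz
          rw [f.zero_on_compl, Pi.zero_apply, Complex.ofReal_zero]
          intro hzK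
          have := hA hzK
          rw [mem_closedBall_zero_iff, Real.norm_eq_abs] at this
          exact absurd (this.trans (le_max_left _ _)) (not_le.2 hz)
        · intro i hi z
          have h1 := Complex.ofRealCLM.norm_iteratedFDeriv_comp_left (f := f) (x := z) (N := ∞)
            (n := i) f.contDiff.contDiffAt (by exact_mod_cast le_top)
          rw [norm_iteratedFDeriv_eq_norm_iteratedDeriv, Complex.ofRealCLM_norm, one_mul] at h1
          refine h1.trans ((ContDiffMapSupportedIn.norm_iteratedFDeriv_apply_le_seminorm_top
            ℝ).trans ?_)
          exact Seminorm.le_finset_sup_apply (Finset.mem_range.2 (Nat.lt_succ_of_le hi)))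

theorem conv_apply (T S : Dist) (f : 𝓓((⊤ : Opens ℝ), ℝ)) :
    conv T S f = convPair T S (fun x => (f x : ℂ)) := rfl

end

section

/-! ### The directing ultrafilter on the set of test functions -/

open Classical in
/-- The radius of support of a test function (with the value `1` at `0`). -/
noncomputable def supportRadius (φ : TestFn) : ℝ :=
  if φ = 0 then 1 else sSup {r : ℝ | ∃ x : ℝ, φ x ≠ 0 ∧ r = |x|}

/-- The `n`-th directing set of test functions, `n ≥ 1`. -/
def directing (n : ℕ) : Set TestFn :=
  {φ | (∀ x, (φ x).im = 0) ∧ (∀ x, φ (-x) = φ x) ∧ supportRadius φ ≤ 1 / (n : ℝ) ∧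
    ∫ x, φ x = 1 ∧ (∀ k : ℕ, 1 ≤ k → k ≤ n → ∫ x : ℝ, (x : ℂ) ^ k * φ x = 0) ∧
    ∫ x, ‖φ x‖ ≤ 1 + 1 / (n : ℝ) ∧
    ∀ k ≤ n, ∀ x, ‖iteratedDeriv k φ x‖ ≤ (supportRadius φ)⁻¹ ^ (2 * (k + 1))}

/-- An ultrafilter on the set of test functions that contains all the directing sets. -/
structure DirectingUltrafilter where
  /-- the underlying ultrafilter -/
  toUltrafilter : Ultrafilter TestFn
  directing_mem : ∀ n : ℕ, 1 ≤ n → directing n ∈ toUltrafilter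

/-- A property of test functions holds almost everywhere. -/
def DirectingUltrafilter.AE (U : DirectingUltrafilter) (p : TestFn → Prop) : Prop :=
  ∀ᶠ φ in (U.toUltrafilter : Filter TestFn), p φ

theorem abs_le_supportRadius {φ : TestFn} {x : ℝ} (h : φ x ≠ 0) : |x| ≤ supportRadius φ := by
  have h0 : φ ≠ 0 := by rintro rfl; exact h rfl
  rw [supportRadius, if_neg h0]
  obtain ⟨A, -, hA⟩ := (isTest_coe φ).exists_radius
  refine le_csSup ⟨A, ?_⟩ ⟨x, h, rfl⟩
  rintro r ⟨y, hy, rfl⟩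
  by_contra hlt
  exact hy (hA y (not_le.1 hlt))

theorem supportRadius_pos {φ : TestFn} (h : ∫ x, φ x = 1) : 0 < supportRadius φ := by
  by_contra hle
  rw [not_lt] at hle
  have h1 : ∀ x : ℝ, x ≠ 0 → φ x = 0 := by
    intro x hx
    by_contra h2
    exact hx (abs_nonpos_iff.1 ((abs_le_supportRadius h2).trans hle))
  have h2 : (fun x => φ x) =ᵐ[volume] fun _ => (0 : ℂ) := by
    filter_upwards [compl_mem_ae_iff.2 (measure_singleton (0 : ℝ))] with x hx
    exact h1 x hx
  rw [integral_congr_ae h2] at h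
  simp at h

variable (U : DirectingUltrafilter)

theorem ae_directing (n : ℕ) (hn : 1 ≤ n) :
    ∀ᶠ φ in (U.toUltrafilter : Filter TestFn), φ ∈ directing n := U.directing_mem n hn

theorem ae_radius_pos : ∀ᶠ φ in (U.toUltrafilter : Filter TestFn), 0 < supportRadius φ := by
  filter_upwards [ae_directing U 1 le_rfl] with φ h
  exact supportRadius_pos h.2.2.2.1

theorem ae_le_inv (c : ℝ) :
    ∀ᶠ φ in (U.toUltrafilter : Filter TestFn), c ≤ (supportRadius φ)⁻¹ := by
  obtain ⟨n, hn⟩ := exists_nat_ge c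
  filter_upwards [ae_directing U (n + 1) (by omega), ae_radius_pos U] with φ h h0
  have h1 := h.2.2.1
  have h2 : (0 : ℝ) < ((n + 1 : ℕ) : ℝ) := by positivity
  have h3 : ((n + 1 : ℕ) : ℝ) ≤ (supportRadius φ)⁻¹ := by
    rw [le_inv_comm₀ h2 h0, inv_eq_one_div]; exact h1
  push_cast at h3
  linarith

/-! ### Generalized numbers and generalized functions -/

/-- A net of complex numbers is moderate. -/
def IsModerateNum (a : TestFn → ℂ) : Prop :=
  ∃ m : ℕ, U.AE fun φ => ‖a φ‖ ≤ (supportRadius φ)⁻¹ ^ m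

/-- A net of complex numbers is negligible. -/
def IsNegligibleNum (a : TestFn → ℂ) : Prop :=
  ∀ p : ℕ, U.AE fun φ => ‖a φ‖ ≤ supportRadius φ ^ p

/-- A net of functions on the real line consists of smooth functions and is moderate. -/
def IsModerateFun (f : TestFn → ℝ → ℂ) : Prop :=
  (∀ φ, ContDiff ℝ ∞ (f φ)) ∧ ∀ K : Set ℝ, IsCompact K → ∀ k : ℕ, ∃ m : ℕ,
    U.AE fun φ => ∀ x ∈ K, ‖iteratedDeriv k (f φ) x‖ ≤ (supportRadius φ)⁻¹ ^ m

/-- A net of functions on the real line is negligible. -/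
def IsNegligibleFun (f : TestFn → ℝ → ℂ) : Prop :=
  ∀ K : Set ℝ, IsCompact K → ∀ k p : ℕ,
    U.AE fun φ => ∀ x ∈ K, ‖iteratedDeriv k (f φ) x‖ ≤ supportRadius φ ^ p

variable {U}

theorem mod_lift {a : TestFn → ℝ} {b : TestFn → ℝ} {m : ℕ} (c : ℝ)
    (h : ∀ᶠ φ in (U.toUltrafilter : Filter TestFn), b φ ≤ (supportRadius φ)⁻¹ ^ m)
    (hab : ∀ᶠ φ in (U.toUltrafilter : Filter TestFn), a φ ≤ c * b φ) (hc : 0 ≤ c) :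
    ∀ᶠ φ in (U.toUltrafilter : Filter TestFn), a φ ≤ (supportRadius φ)⁻¹ ^ (m + 1) := by
  filter_upwards [h, hab, ae_le_inv U c, ae_radius_pos U] with φ h1 h2 h3 h4
  calc a φ ≤ c * b φ := h2
    _ ≤ c * (supportRadius φ)⁻¹ ^ m := by gcongr
    _ ≤ (supportRadius φ)⁻¹ * (supportRadius φ)⁻¹ ^ m := by gcongr
    _ = _ := by ring

theorem inv_pow_mono {φ : TestFn} (h : 1 ≤ (supportRadius φ)⁻¹) {m n : ℕ} (hmn : m ≤ n) :
    (supportRadius φ)⁻¹ ^ m ≤ (supportRadius φ)⁻¹ ^ n := pow_le_pow_right₀ h hmn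

theorem IsModerateNum.add {a b : TestFn → ℂ} (ha : IsModerateNum U a) (hb : IsModerateNum U b) :
    IsModerateNum U (a + b) := by
  obtain ⟨m, hm⟩ := ha
  obtain ⟨n, hn⟩ := hb
  refine ⟨max m n + 1, mod_lift (b := fun φ => (supportRadius φ)⁻¹ ^ (max m n)) 2
    (Eventually.of_forall fun φ => le_rfl) ?_ zero_le_two⟩
  filter_upwards [hm, hn, ae_le_inv U 1] with φ h1 h2 h3
  have h4 := inv_pow_mono h3 (le_max_left m n)
  have h5 := inv_pow_mono h3 (le_max_right m n)
  have := norm_add_le (a φ) (b φ)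
  simp only [Pi.add_apply]
  linarith

theorem IsModerateNum.mul {a b : TestFn → ℂ} (ha : IsModerateNum U a) (hb : IsModerateNum U b) :
    IsModerateNum U (a * b) := by
  obtain ⟨m, hm⟩ := ha
  obtain ⟨n, hn⟩ := hb
  refine ⟨m + n, ?_⟩
  filter_upwards [hm, hn, ae_le_inv U 0] with φ h1 h2 h3
  rw [Pi.mul_apply, norm_mul, pow_add]
  gcongr

theorem isModerateNum_const (c : ℂ) : IsModerateNum U (fun _ => c) := by
  refine ⟨1, ?_⟩
  filter_upwards [ae_le_inv U ‖c‖] with φ h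
  rwa [pow_one]

/-- Simultaneous estimates for the derivatives up to a given order. -/
theorem IsModerateFun.bound {f : TestFn → ℝ → ℂ} (hf : IsModerateFun U f) {K : Set ℝ}
    (hK : IsCompact K) (k : ℕ) : ∃ m : ℕ, ∀ᶠ φ in (U.toUltrafilter : Filter TestFn),
      ∀ i ≤ k, ∀ x ∈ K, ‖iteratedDeriv i (f φ) x‖ ≤ (supportRadius φ)⁻¹ ^ m := by
  choose m hm using fun i => hf.2 K hK i
  refine ⟨(Finset.range (k + 1)).sup m, ?_⟩
  have h1 : ∀ᶠ φ in (U.toUltrafilter : Filter TestFn), ∀ i ∈ Finset.range (k + 1), ∀ x ∈ K,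
      ‖iteratedDeriv i (f φ) x‖ ≤ (supportRadius φ)⁻¹ ^ (m i) :=
    (eventually_all_finset _).2 fun i _ => hm i
  filter_upwards [h1, ae_le_inv U 1] with φ h2 h3 i hi x hx
  have hi' : i ∈ Finset.range (k + 1) := Finset.mem_range.2 (Nat.lt_succ_of_le hi)
  exact (h2 i hi' x hx).trans (inv_pow_mono h3 (Finset.le_sup hi'))

theorem IsNegligibleFun.bound {f : TestFn → ℝ → ℂ} (hf : IsNegligibleFun U f) {K : Set ℝ}
    (hK : IsCompact K) (k p : ℕ) : ∀ᶠ φ in (U.toUltrafilter : Filter TestFn),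
      ∀ i ≤ k, ∀ x ∈ K, ‖iteratedDeriv i (f φ) x‖ ≤ supportRadius φ ^ p := by
  have h1 : ∀ᶠ φ in (U.toUltrafilter : Filter TestFn), ∀ i ∈ Finset.range (k + 1), ∀ x ∈ K,
      ‖iteratedDeriv i (f φ) x‖ ≤ supportRadius φ ^ p :=
    (eventually_all_finset _).2 fun i _ => hf K hK i p
  filter_upwards [h1] with φ h2 i hi x hx
  exact h2 i (Finset.mem_range.2 (Nat.lt_succ_of_le hi)) x hx

theorem norm_iteratedDeriv_mul_le {f g : ℝ → ℂ} (hf : ContDiff ℝ ∞ f) (hg : ContDiff ℝ ∞ g)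
    (k : ℕ) (x : ℝ) {A B : ℝ} (hA : ∀ i ≤ k, ‖iteratedDeriv i f x‖ ≤ A)
    (hB : ∀ i ≤ k, ‖iteratedDeriv i g x‖ ≤ B) :
    ‖iteratedDeriv k (f * g) x‖ ≤ 2 ^ k * (A * B) := by
  have hA0 : 0 ≤ A := (norm_nonneg _).trans (hA 0 (Nat.zero_le _))
  have := norm_iteratedFDeriv_mul_le (𝕜 := ℝ) (N := ∞) hf hg x (n := k) (by exact_mod_cast le_top)
  simp only [norm_iteratedFDeriv_eq_norm_iteratedDeriv] at this
  refine this.trans ?_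
  calc _ ≤ ∑ i ∈ Finset.range (k + 1), (k.choose i : ℝ) * A * B := by
        refine Finset.sum_le_sum fun i hi => ?_
        have := Finset.mem_range.1 hi
        gcongr
        · exact hA i (by omega)
        · exact hB _ (by omega)
    _ = _ := by
        simp_rw [mul_assoc]
        rw [← Finset.sum_mul]
        congr 1
        exact_mod_cast Nat.sum_range_choose k

theorem IsModerateFun.add {f g : TestFn → ℝ → ℂ} (hf : IsModerateFun U f)
    (hg : IsModerateFun U g) : IsModerateFun U (f + g) := by
  refine ⟨fun φ => (hf.1 φ).add (hg.1 φ), fun K hK k => ?_⟩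
  obtain ⟨m, hm⟩ := hf.2 K hK k
  obtain ⟨n, hn⟩ := hg.2 K hK k
  refine ⟨max m n + 1, ?_⟩
  filter_upwards [hm, hn, ae_le_inv U 2] with φ h1 h2 h3 x hx
  have h4 := inv_pow_mono (one_le_two.trans h3) (le_max_left m n)
  have h5 := inv_pow_mono (one_le_two.trans h3) (le_max_right m n)
  rw [Pi.add_apply, iteratedDeriv_add ((hf.1 φ).of_le (by exact_mod_cast le_top)).contDiffAt
    ((hg.1 φ).of_le (by exact_mod_cast le_top)).contDiffAt]
  calc _ ≤ ‖iteratedDeriv k (f φ) x‖ + ‖iteratedDeriv k (g φ) x‖ := norm_add_le _ _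
    _ ≤ 2 * (supportRadius φ)⁻¹ ^ (max m n) := by
        have := h1 x hx; have := h2 x hx; linarith
    _ ≤ (supportRadius φ)⁻¹ * (supportRadius φ)⁻¹ ^ (max m n) := by
        have : (0 : ℝ) ≤ (supportRadius φ)⁻¹ := zero_le_two.trans h3
        gcongr
    _ = _ := by ring

theorem IsModerateFun.mul {f g : TestFn → ℝ → ℂ} (hf : IsModerateFun U f)
    (hg : IsModerateFun U g) : IsModerateFun U (f * g) := by
  refine ⟨fun φ => (hf.1 φ).mul (hg.1 φ), fun K hK k => ?_⟩
  obtain ⟨m, hm⟩ := hf.bound hK k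
  obtain ⟨n, hn⟩ := hg.bound hK k
  refine ⟨m + n + 1, ?_⟩
  filter_upwards [hm, hn, ae_le_inv U (2 ^ k)] with φ h1 h2 h3 x hx
  have h0 : (0 : ℝ) ≤ (supportRadius φ)⁻¹ := (by positivity : (0 : ℝ) ≤ 2 ^ k).trans h3
  refine (norm_iteratedDeriv_mul_le (hf.1 φ) (hg.1 φ) k x (fun i hi => h1 i hi x hx)
    (fun i hi => h2 i hi x hx)).trans ?_
  rw [← pow_add, pow_succ' _ (m + n)]
  gcongr

theorem IsModerateNum.const {a : TestFn → ℂ} (ha : IsModerateNum U a) :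
    IsModerateFun U (fun φ _ => a φ) := by
  refine ⟨fun φ => contDiff_const, fun K _ k => ?_⟩
  obtain ⟨m, hm⟩ := ha
  refine ⟨m, ?_⟩
  filter_upwards [hm, ae_le_inv U 0] with φ h1 h2 x _
  rw [iteratedDeriv_const]
  split_ifs
  · exact h1
  · rw [norm_zero]; positivity

theorem IsModerateFun.deriv {f : TestFn → ℝ → ℂ} (hf : IsModerateFun U f) :
    IsModerateFun U (fun φ => _root_.deriv (f φ)) := by
  refine ⟨fun φ => (contDiff_infty_iff_deriv.1 (hf.1 φ)).2, fun K hK k => ?_⟩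
  obtain ⟨m, hm⟩ := hf.2 K hK (k + 1)
  refine ⟨m, ?_⟩
  filter_upwards [hm] with φ h x hx
  rw [← iteratedDeriv_succ']
  exact h x hx

theorem IsModerateFun.eval {f : TestFn → ℝ → ℂ} (hf : IsModerateFun U f) (x : ℝ) :
    IsModerateNum U (fun φ => f φ x) := by
  obtain ⟨m, hm⟩ := hf.2 {x} isCompact_singleton 0
  refine ⟨m, ?_⟩
  filter_upwards [hm] with φ h
  simpa using h x rfl

variable (U) in
/-- The algebra of moderate nets of complex numbers. -/
def moderateNum : Subalgebra ℂ (TestFn → ℂ) where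
  carrier := {a | IsModerateNum U a}
  mul_mem' := IsModerateNum.mul
  add_mem' := IsModerateNum.add
  algebraMap_mem' := isModerateNum_const

variable (U) in
/-- The algebra of moderate nets of smooth functions. -/
def moderateFun : Subalgebra ℂ (TestFn → ℝ → ℂ) where
  carrier := {f | IsModerateFun U f}
  mul_mem' := IsModerateFun.mul
  add_mem' := IsModerateFun.add
  algebraMap_mem' c := (isModerateNum_const c).const

variable (U) in
/-- The ideal of negligible nets of complex numbers. -/
def negligibleNum : Ideal (moderateNum U) where
  carrier := {a | IsNegligibleNum U a.1}
  zero_mem' p := by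
    filter_upwards [ae_radius_pos U] with φ h
    change ‖(0 : ℂ)‖ ≤ _
    rw [norm_zero]; positivity
  add_mem' {a b} ha hb p := by
    filter_upwards [ha (p + 1), hb (p + 1), ae_le_inv U 2, ae_radius_pos U] with φ h1 h2 h3 h4
    have h5 : supportRadius φ * 2 ≤ 1 := by
      rw [← le_div_iff₀' h4, one_div]; exact h3
    calc ‖a.1 φ + b.1 φ‖ ≤ ‖a.1 φ‖ + ‖b.1 φ‖ := norm_add_le _ _
      _ ≤ supportRadius φ ^ p * (supportRadius φ * 2) := by
          rw [pow_succ] at h1 h2; linarith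
      _ ≤ supportRadius φ ^ p * 1 := by gcongr
      _ = _ := mul_one _
  smul_mem' c a ha p := by
    obtain ⟨m, hm⟩ := c.2
    filter_upwards [ha (p + m), hm, ae_radius_pos U] with φ h1 h2 h3
    calc ‖c.1 φ * a.1 φ‖ = ‖c.1 φ‖ * ‖a.1 φ‖ := norm_mul _ _
      _ ≤ (supportRadius φ)⁻¹ ^ m * supportRadius φ ^ (p + m) := by gcongr
      _ = supportRadius φ ^ p := by
          rw [pow_add, inv_pow]; field_simp

variable (U) in
/-- The ideal of negligible nets of smooth functions. -/
def negligibleFun : Ideal (moderateFun U) where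
  carrier := {f | IsNegligibleFun U f.1}
  zero_mem' K hK k p := by
    filter_upwards [ae_radius_pos U] with φ h x hx
    change ‖iteratedDeriv k (fun _ => (0 : ℂ)) x‖ ≤ _
    simp only [iteratedDeriv_const, ite_self, norm_zero]
    positivity
  add_mem' {f g} hf hg K hK k p := by
    filter_upwards [hf K hK k (p + 1), hg K hK k (p + 1), ae_le_inv U 2, ae_radius_pos U]
      with φ h1 h2 h3 h4 x hx
    have h5 : supportRadius φ * 2 ≤ 1 := by
      rw [← le_div_iff₀' h4, one_div]; exact h3
    have h6 := h1 x hx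
    have h7 := h2 x hx
    change ‖iteratedDeriv k (f.1 φ + g.1 φ) x‖ ≤ _
    rw [iteratedDeriv_add ((f.2.1 φ).of_le (by exact_mod_cast le_top)).contDiffAt
      ((g.2.1 φ).of_le (by exact_mod_cast le_top)).contDiffAt]
    calc _ ≤ ‖iteratedDeriv k (f.1 φ) x‖ + ‖iteratedDeriv k (g.1 φ) x‖ := norm_add_le _ _
      _ ≤ supportRadius φ ^ p * (supportRadius φ * 2) := by
          rw [pow_succ] at h6 h7; linarith
      _ ≤ supportRadius φ ^ p * 1 := by gcongr
      _ = _ := mul_one _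
  smul_mem' c f hf K hK k p := by
    obtain ⟨m, hm⟩ := IsModerateFun.bound c.2 hK k
    filter_upwards [IsNegligibleFun.bound hf hK k (p + m + 1), hm, ae_radius_pos U,
      ae_le_inv U (2 ^ k)] with φ h1 h2 h3 h4 x hx
    have h5 : 2 ^ k * supportRadius φ ≤ 1 := by
      rw [← le_div_iff₀ h3, one_div]; exact h4
    refine (norm_iteratedDeriv_mul_le (c.2.1 φ) (f.2.1 φ) k x (fun i hi => h2 i hi x hx)
      (fun i hi => h1 i hi x hx)).trans ?_
    calc _ = (2 ^ k * supportRadius φ) * supportRadius φ ^ p := by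
          rw [pow_succ, pow_add, inv_pow]; field_simp
      _ ≤ 1 * supportRadius φ ^ p := by gcongr
      _ = _ := one_mul _

variable (U)

/-- The generalized complex numbers: moderate nets modulo negligible nets. -/
def GenNum : Type := moderateNum U ⧸ negligibleNum U

noncomputable instance : CommRing (GenNum U) :=
  inferInstanceAs (CommRing (moderateNum U ⧸ negligibleNum U))

noncomputable instance : Algebra ℂ (GenNum U) :=
  inferInstanceAs (Algebra ℂ (moderateNum U ⧸ negligibleNum U))

noncomputable instance : Algebra ℝ (GenNum U) :=
  inferInstanceAs (Algebra ℝ (moderateNum U ⧸ negligibleNum U))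

/-- The algebra of generalized functions on the real line: moderate nets of smooth functions
modulo negligible nets. -/
def GenFun : Type := moderateFun U ⧸ negligibleFun U

noncomputable instance : CommRing (GenFun U) :=
  inferInstanceAs (CommRing (moderateFun U ⧸ negligibleFun U))

noncomputable instance : Algebra ℂ (GenFun U) :=
  inferInstanceAs (Algebra ℂ (moderateFun U ⧸ negligibleFun U))

noncomputable instance : Algebra ℝ (GenFun U) :=
  inferInstanceAs (Algebra ℝ (moderateFun U ⧸ negligibleFun U))

variable {U}

/-- The class `q(a)` of a moderate net of numbers. -/
noncomputable def GenNum.mk : moderateNum U →+* GenNum U := Ideal.Quotient.mk (negligibleNum U)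

/-- The class `q(f)` of a moderate net of smooth functions. -/
noncomputable def GenFun.mk : moderateFun U →+* GenFun U := Ideal.Quotient.mk (negligibleFun U)

theorem GenNum.mk_surjective : Function.Surjective (GenNum.mk : moderateNum U → GenNum U) :=
  Ideal.Quotient.mk_surjective

theorem GenFun.mk_surjective : Function.Surjective (GenFun.mk : moderateFun U → GenFun U) :=
  Ideal.Quotient.mk_surjective

theorem GenNum.mk_eq_zero {a : moderateNum U} : GenNum.mk a = 0 ↔ IsNegligibleNum U a.1 :=
  Ideal.Quotient.eq_zero_iff_mem

theorem GenFun.mk_eq_zero {f : moderateFun U} : GenFun.mk f = 0 ↔ IsNegligibleFun U f.1 :=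
  Ideal.Quotient.eq_zero_iff_mem

/-- Constant nets of functions. -/
def constNet : moderateNum U →+* moderateFun U where
  toFun a := ⟨fun φ _ => a.1 φ, IsModerateNum.const a.2⟩
  map_one' := rfl
  map_mul' _ _ := rfl
  map_zero' := rfl
  map_add' _ _ := rfl

theorem constNet_mem {a : moderateNum U} (ha : a ∈ negligibleNum U) :
    constNet a ∈ negligibleFun U := by
  intro K hK k p
  filter_upwards [ha p, ae_radius_pos U] with φ h1 h2 x _
  change ‖iteratedDeriv k (fun _ => a.1 φ) x‖ ≤ _
  rw [iteratedDeriv_const]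
  split_ifs
  · exact h1
  · rw [norm_zero]; positivity

/-- The embedding of generalized numbers as constant generalized functions. -/
noncomputable def constHom : GenNum U →+* GenFun U :=
  Ideal.quotientMap (negligibleFun U) constNet fun _ ha => constNet_mem ha

/-- Generalized functions form an algebra over the generalized numbers. -/
noncomputable instance : Algebra (GenNum U) (GenFun U) := constHom.toAlgebra

theorem GenFun.mk_smul_mk (a : moderateNum U) (f : moderateFun U) :
    GenNum.mk a • GenFun.mk f = GenFun.mk (constNet a * f) := rfl

/-- Values of nets at a real point. -/
def evalNet (x : ℝ) : moderateFun U →+* moderateNum U where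
  toFun f := ⟨fun φ => f.1 φ x, IsModerateFun.eval f.2 x⟩
  map_one' := rfl
  map_mul' _ _ := rfl
  map_zero' := rfl
  map_add' _ _ := rfl

theorem evalNet_mem (x : ℝ) {f : moderateFun U} (hf : f ∈ negligibleFun U) :
    evalNet x f ∈ negligibleNum U := by
  intro p
  filter_upwards [hf {x} isCompact_singleton 0 p] with φ h
  have h1 := h x rfl
  rw [iteratedDeriv_zero] at h1
  exact h1

/-- The value `f(x) = q(f_φ(x))` of a generalized function at a real point. -/
noncomputable def GenFun.eval (x : ℝ) : GenFun U →+* GenNum U :=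
  Ideal.quotientMap (negligibleNum U) (evalNet x) fun _ hf => evalNet_mem x hf

theorem GenFun.eval_mk (x : ℝ) (f : moderateFun U) :
    GenFun.eval x (GenFun.mk f) = GenNum.mk (evalNet x f) := rfl

/-- The derivative of a moderate net, taken for each index. -/
noncomputable def derivNet (f : moderateFun U) : moderateFun U :=
  ⟨fun φ => deriv (f.1 φ), IsModerateFun.deriv f.2⟩

theorem derivNet_sub (f g : moderateFun U) : derivNet (f - g) = derivNet f - derivNet g := by
  ext φ x
  exact deriv_sub ((contDiff_infty_iff_deriv.1 (f.2.1 φ)).1 x)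
    ((contDiff_infty_iff_deriv.1 (g.2.1 φ)).1 x)

theorem derivNet_mem {f : moderateFun U} (hf : f ∈ negligibleFun U) :
    derivNet f ∈ negligibleFun U := by
  intro K hK k p
  filter_upwards [hf K hK (k + 1) p] with φ h x hx
  change ‖iteratedDeriv k (deriv (f.1 φ)) x‖ ≤ _
  rw [← iteratedDeriv_succ']
  exact h x hx

/-- The derivative of a generalized function. -/
noncomputable def GenFun.D (f : GenFun U) : GenFun U :=
  Quotient.liftOn' f (fun a => GenFun.mk (derivNet a)) (by
    intro a b h
    have h1 : a - b ∈ negligibleFun U := (Submodule.quotientRel_def _).1 h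
    refine Ideal.Quotient.eq.2 ?_
    rw [← derivNet_sub]
    exact derivNet_mem h1)

theorem GenFun.D_mk (a : moderateFun U) :
    GenFun.D (GenFun.mk a) = GenFun.mk (derivNet a) := rfl

/-- A generalized number is infinitesimal if for every `n ≥ 1` its absolute value is less than
`1 / n`, that is, some representative is bounded by `1 / n` almost everywhere. -/
def IsInfinitesimal (x : GenNum U) : Prop :=
  ∀ n : ℕ, 1 ≤ n → ∃ a : moderateNum U, GenNum.mk a = x ∧
    U.AE fun φ => ‖a.1 φ‖ < 1 / (n : ℝ)

/-- Two generalized numbers are infinitely close. -/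
def InfClose (x y : GenNum U) : Prop := IsInfinitesimal (x - y)

end

section

/-! ### The embedding of distributions -/

theorem iteratedDeriv_eq_zero_of_radius {f : ℝ → ℂ} {A : ℝ} (hA : ∀ z, A < |z| → f z = 0) (k : ℕ)
    (z : ℝ) (hz : A < |z|) : iteratedDeriv k f z = 0 := by
  have : f =ᶠ[𝓝 z] fun _ => 0 := by
    filter_upwards [(isOpen_lt continuous_const continuous_abs).mem_nhds hz] with w hw
    exact hA w hw
  rw [this.iteratedDeriv_eq]
  simp

theorem iteratedDeriv_add_order (j i : ℕ) (f : ℝ → ℂ) :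
    iteratedDeriv j (iteratedDeriv i f) = iteratedDeriv (j + i) f := by
  rw [iteratedDeriv_eq_iterate, iteratedDeriv_eq_iterate, iteratedDeriv_eq_iterate,
    Function.iterate_add_apply]

theorem directing_eq_zero {n : ℕ} (hn : 1 ≤ n) {φ : TestFn} (h : φ ∈ directing n) (z : ℝ)
    (hz : 1 < |z|) : φ z = 0 := by
  by_contra h0
  have h1 : (1 : ℝ) ≤ n := by exact_mod_cast hn
  have h2 := (abs_le_supportRadius h0).trans h.2.2.1
  have h3 : 1 / (n : ℝ) ≤ 1 := by rw [div_le_one (by linarith)]; exact h1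
  linarith

theorem isModerateFun_reg (U : DirectingUltrafilter) (T : Dist) :
    IsModerateFun U (fun φ => reg T φ) := by
  refine ⟨fun φ => ?_, fun K hK k => ?_⟩
  · change ContDiff ℝ ∞ (reg T φ)
    rw [reg_eq_kern]; exact contDiff_kern contDiff_const (by simp) (isTest_coe φ)
  · obtain ⟨X, hX⟩ := hK.isBounded.subset_closedBall 0
    obtain ⟨C, hC, N, h⟩ := kern_bound (η := fun _ => 1) (σ := -1) T contDiff_const (by simp) 1 X
    refine ⟨2 * (N + k + 1) + 1, ?_⟩
    filter_upwards [ae_directing U (N + k + 1) (by omega), ae_le_inv U C, ae_le_inv U 1]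
      with φ h1 h2 h3 x hx
    have hx' := hX hx
    rw [mem_closedBall_zero_iff, Real.norm_eq_abs] at hx'
    rw [reg_eq_kern, iteratedDeriv_kern contDiff_const (by simp) (isTest_coe φ)]
    refine (h _ ((isTest_coe φ).iteratedDeriv k).1 (iteratedDeriv_eq_zero_of_radius
      (fun z hz => directing_eq_zero (by omega) h1 z hz) k) x hx'
      ((supportRadius φ)⁻¹ ^ (2 * (N + k + 1))) (by positivity) fun i hi z => ?_).trans ?_
    · rw [iteratedDeriv_add_order]
      exact (h1.2.2.2.2.2.2 (i + k) (by omega) z).trans (inv_pow_mono h3 (by omega))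
    · rw [pow_succ' _ (2 * (N + k + 1))]
      gcongr

variable (U : DirectingUltrafilter)

/-- The canonical embedding `ι(T) = q(T ⋆ φ)` of distributions in generalized functions. -/
noncomputable def ι (T : Dist) : GenFun U :=
  GenFun.mk ⟨fun φ => reg T φ, isModerateFun_reg U T⟩

/-- The distributions supported in `[0, ∞)`. -/
def dPlus : Set Dist := {T | Distribution.IsVanishingOn T (Set.Iio (0 : ℝ))}

/-- The span of `ι(S)` over the generalized numbers. -/
noncomputable def spanHat (S : Set Dist) : Submodule (GenNum U) (GenFun U) :=
  Submodule.span (GenNum U) (ι U '' S)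

theorem pair_eq_zero {S : Dist} (hS : S ∈ dPlus) {f : ℝ → ℂ} (hf : ∀ y, -1 < y → f y = 0) :
    pair S f = 0 := by
  by_cases h : IsTest f
  · have key : ∀ g : ℝ → ℝ, (∀ y, -1 < y → g y = 0) → tsupport g ⊆ Set.Iio 0 := by
      intro g hg
      have : tsupport g ⊆ Set.Iic (-1) := by
        refine closure_minimal (fun y hy => ?_) isClosed_Iic
        by_contra hlt
        exact hy (hg y (not_le.1 hlt))
      exact this.trans (Set.Iic_subset_Iio.2 (by norm_num))
    rw [pair, dif_pos h, hS _ (key (fun x => (f x).re) fun y hy => by simp only [hf y hy]; rfl),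
      hS _ (key (fun x => (f x).im) fun y hy => by simp only [hf y hy]; rfl)]
    simp
  · rw [pair, dif_neg h]

theorem IsTest.comp_affine {f : ℝ → ℂ} (h : IsTest f) {σ : ℝ} (hσ : |σ| = 1) (x : ℝ) :
    IsTest (fun y => f (x + σ * y)) := by
  simpa using isTest_kern (η := fun _ => 1) contDiff_const hσ h x

theorem pair_cutoff {S : Dist} (hS : S ∈ dPlus) {f : ℝ → ℂ} (hf : IsTest f) :
    pair S (fun y => cutoff y * f y) = pair S f := by
  have h1 : IsTest (fun y => cutoff y * f y) :=
    ⟨contDiff_cutoff.mul hf.1, hf.2.mul_left⟩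
  have h2 := pair_add S h1 (hf.const_mul (-1))
  have h3 := pair_const_mul S (-1) hf
  have h4 : pair S (fun y => cutoff y * f y + -1 * f y) = 0 := by
    refine pair_eq_zero hS fun y hy => ?_
    rw [cutoff_eq_one hy.le]; ring
  rw [h4, h3] at h2
  linear_combination -h2

theorem pair_conv (T S : Dist) {f : ℝ → ℂ} (hf : IsTest f) :
    pair (conv T S) f = convPair T S f := by
  have hr : IsTest (fun x => ((f x).re : ℂ)) := isTest_ofReal ⟨_, hf.re.1, hf.re.2, Set.subset_univ _⟩
  have hi : IsTest (fun x => ((f x).im : ℂ)) := isTest_ofReal ⟨_, hf.im.1, hf.im.2, Set.subset_univ _⟩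
  have e : f = fun x => ((f x).re : ℂ) + Complex.I * ((f x).im : ℂ) := by
    ext x
    rw [mul_comm]
    exact (Complex.re_add_im _).symm
  rw [pair, dif_pos hf, conv_apply, conv_apply]
  conv_rhs => rw [e]
  rw [convPair_add T S hr (hi.const_mul _), convPair_const_mul T S _ hi]
  rfl

theorem kern_conv_aux {S : Dist} (hS : S ∈ dPlus) {f : ℝ → ℂ} (hf : IsTest f) (x z : ℝ) :
    pair S (fun y => cutoff y * f (x - (z + y))) = kern S (fun _ => 1) (-1) f (x - z) := by
  have h := hf.comp_affine (σ := -1) (by simp) (x - z)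
  rw [kern]
  simp only [one_mul]
  rw [← pair_cutoff hS h]
  congr 1; ext y; congr 2; ring

theorem kern_conv (T : Dist) {S : Dist} (hS : S ∈ dPlus) {f : ℝ → ℂ} (hf : IsTest f) (x : ℝ) :
    kern (conv T S) (fun _ => 1) (-1) f x =
      pair T (fun z => cutoff z * kern S (fun _ => 1) (-1) f (x - z)) := by
  have h := hf.comp_affine (σ := -1) (by simp) x
  rw [kern]
  simp only [one_mul]
  rw [pair_conv T S h, convPair]
  congr 1; ext z
  rw [← kern_conv_aux hS hf]
  congr 3; ext y; congr 2; ring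

theorem isTest_kern_conv {S : Dist} (hS : S ∈ dPlus) {f : ℝ → ℂ} (hf : IsTest f) (x : ℝ) :
    IsTest (fun z => cutoff z * kern S (fun _ => 1) (-1) f (x - z)) := by
  have h := isTest_cutoff_kern S (hf.comp_affine (σ := -1) (by simp) x)
  convert h using 2 with z
  rw [← kern_conv_aux hS hf, kern]
  congr 2; ext y; congr 2; ring

theorem pair_sum {κ : Type} (T : Dist) (s : Finset κ) (c : κ → ℂ) (f : κ → ℝ → ℂ)
    (hf : ∀ i ∈ s, IsTest (f i)) :
    IsTest (fun x => ∑ i ∈ s, c i * f i x) ∧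
      pair T (fun x => ∑ i ∈ s, c i * f i x) = ∑ i ∈ s, c i * pair T (f i) := by
  classical
  induction s using Finset.induction_on with
  | empty =>
    simp only [Finset.sum_empty]
    exact ⟨⟨contDiff_const, HasCompactSupport.zero⟩, pair_zero T⟩
  | insert a s ha ih =>
    obtain ⟨h1, h2⟩ := ih fun i hi => hf i (Finset.mem_insert_of_mem hi)
    have h3 := (hf a (Finset.mem_insert_self a s)).const_mul (c a)
    simp only [Finset.sum_insert ha]
    refine ⟨h3.add h1, ?_⟩
    rw [pair_add T h3 h1, h2, pair_const_mul T _ (hf a (Finset.mem_insert_self a s))]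

theorem iteratedDeriv_sum_kern (s : Finset dPlus) (c : dPlus → ℂ) (S : dPlus → Dist) {f : ℝ → ℂ}
    (hf : IsTest f) (k : ℕ) :
    iteratedDeriv k (fun x => ∑ i ∈ s, c i * kern (S i) (fun _ => 1) (-1) f x) =
      fun x => ∑ i ∈ s, c i * kern (S i) (fun _ => 1) (-1) (iteratedDeriv k f) x := by
  ext x
  have hc : ∀ i, ContDiff ℝ k (kern (S i) (fun _ => 1) (-1) f) := fun i =>
    (contDiff_kern contDiff_const (by simp) hf).of_le (by exact_mod_cast le_top)
  rw [iteratedDeriv_fun_sum fun i _ => (contDiff_const.mul (hc i)).contDiffAt]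
  refine Finset.sum_congr rfl fun i _ => ?_
  rw [iteratedDeriv_const_mul_field, iteratedDeriv_kern contDiff_const (by simp) hf]

variable {U}

theorem negligible_conv (T : Dist) (s : Finset dPlus) (a : dPlus → TestFn → ℂ)
    (h : IsNegligibleFun U (fun φ x => ∑ S ∈ s, a S φ * reg S.1 φ x)) :
    IsNegligibleFun U (fun φ x => ∑ S ∈ s, a S φ * reg (conv T S.1) φ x) := by
  intro K hK k p
  obtain ⟨X, hX⟩ := hK.isBounded.subset_closedBall 0
  obtain ⟨C, hC, N, hb⟩ := pair_mul_bound T contDiff_cutoff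
    ⟨Metric.closedBall 0 (X + 3), isCompact_closedBall _ _⟩
  filter_upwards [h.bound (isCompact_closedBall (0 : ℝ) (X + (X + 3))) (N + k) (p + 1),
    ae_le_inv U C, ae_radius_pos U, ae_directing U 1 le_rfl] with φ h1 h2 h3 h4 x hx
  have hx' := hX hx
  rw [mem_closedBall_zero_iff, Real.norm_eq_abs] at hx'
  have hφ := isTest_coe φ
  have hk := hφ.iteratedDeriv k
  have hzero : ∀ y, 1 < |y| → iteratedDeriv k φ y = 0 :=
    iteratedDeriv_eq_zero_of_radius (fun z hz => directing_eq_zero le_rfl h4 z hz) k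
  set u : ℝ → ℂ := fun x => ∑ S ∈ s, a S φ * kern S.1 (fun _ => 1) (-1) (iteratedDeriv k φ) x
    with hu
  have e1 : iteratedDeriv k (fun x => ∑ S ∈ s, a S φ * reg S.1 φ x) = u := by
    simp only [reg_eq_kern]
    exact iteratedDeriv_sum_kern s (fun S => a S φ) (fun S => S.1) hφ k
  have hus : ContDiff ℝ ∞ u := ContDiff.sum fun S _ =>
    contDiff_const.mul (contDiff_kern contDiff_const (by simp) hk)
  have e2 : iteratedDeriv k (fun x => ∑ S ∈ s, a S φ * reg (conv T S.1) φ x) x =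
      pair T (fun z => cutoff z * u (x - z)) := by
    simp only [reg_eq_kern]
    rw [iteratedDeriv_sum_kern s (fun S => a S φ) (fun S => conv T S.1) hφ k]
    simp only [hu, Finset.mul_sum]
    rw [Finset.sum_congr rfl fun S _ => by rw [kern_conv T S.2 hk x],
      ← (pair_sum T s (fun S => a S φ) _ fun S _ => isTest_kern_conv S.2 hk x).2]
    congr 1; ext z
    exact Finset.sum_congr rfl fun S _ => by ring
  rw [e2]
  have h5 : C * supportRadius φ ≤ 1 := by
    rw [← le_div_iff₀ h3, one_div]; exact h2
  refine (hb _ (hus.comp (contDiff_const.sub contDiff_id)) ?_ (supportRadius φ ^ (p + 1))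
    (by positivity) ?_).trans ?_
  · intro z hz
    change z ∉ Metric.closedBall 0 (X + 3) at hz
    rw [mem_closedBall_zero_iff, Real.norm_eq_abs, not_le] at hz
    have hx0 := abs_nonneg x
    rcases le_or_gt z 0 with h0 | h0
    · rw [abs_of_nonpos h0] at hz
      rw [cutoff_eq_zero (by linarith), zero_mul]
    · rw [abs_of_pos h0] at hz
      have hxz : x - z < -3 := by
        have := le_abs_self x
        linarith
      have : u (x - z) = 0 := by
        refine Finset.sum_eq_zero fun S _ => ?_
        rw [kern, pair_eq_zero S.2, mul_zero]
        intro y hy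
        rw [hzero, mul_zero]
        rw [abs_of_neg (by linarith)]
        linarith
      simp only [Function.comp, id, this, mul_zero]
  · intro i hi z hz
    change z ∈ Metric.closedBall 0 (X + 3) at hz
    rw [mem_closedBall_zero_iff, Real.norm_eq_abs] at hz
    have e3 : iteratedDeriv i (fun z => u (x - z)) z = (-1 : ℝ) ^ i • iteratedDeriv i u (x - z) := by
      rw [iteratedDeriv_comp_const_sub]
    simp only [Function.comp_def, id]
    rw [e3, norm_smul, norm_pow, norm_neg, norm_one, one_pow, one_mul, ← e1,
      iteratedDeriv_add_order]
    refine h1 _ (by omega) _ ?_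
    rw [mem_closedBall_zero_iff, Real.norm_eq_abs]
    exact (abs_sub _ _).trans (add_le_add hx' hz)
  · calc C * supportRadius φ ^ (p + 1) = (C * supportRadius φ) * supportRadius φ ^ p := by ring
      _ ≤ 1 * supportRadius φ ^ p := by gcongr
      _ = _ := one_mul _

theorem sum_smul_ι (s : Finset dPlus) (a : dPlus → moderateNum U) (S : dPlus → Dist) :
    ∃ h : IsModerateFun U (fun φ x => ∑ i ∈ s, (a i).1 φ * reg (S i) φ x),
    ∑ i ∈ s, (GenNum.mk (a i)) • ι U (S i) =
      GenFun.mk ⟨_, h⟩ := by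
  classical
  induction s using Finset.induction_on with
  | empty =>
    simp only [Finset.sum_empty]
    exact ⟨(isModerateNum_const 0).const, (map_zero _).symm⟩
  | insert j s hj ih =>
    obtain ⟨h1, h2⟩ := ih
    have h3 : IsModerateFun U (fun φ x => (a j).1 φ * reg (S j) φ x) :=
      (IsModerateNum.const (a j).2).mul (isModerateFun_reg U (S j))
    simp only [Finset.sum_insert hj]
    refine ⟨h3.add h1, ?_⟩
    rw [h2]
    rfl

open Classical in
/-- The convolution `T ⋆ f = ∑ αₙ ι(T ⋆ Tₙ)` of a distribution `T` supported in `[0, ∞)` with an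
element `f = ∑ αₙ ι(Tₙ)` of the span of the distributions supported in `[0, ∞)`. It does not depend
on the representation of `f`, see `spanConv_eq`. -/
noncomputable def spanConv (T : Dist) (f : GenFun U) : GenFun U :=
  if h : ∃ l : dPlus →₀ GenNum U, f = l.sum fun S α => α • ι U S.1 then
    h.choose.sum fun S α => α • ι U (conv T S.1)
  else 0

theorem spanConv_aux (T : Dist) (l : dPlus →₀ GenNum U) (h : (l.sum fun S α => α • ι U S.1) = 0) :
    (l.sum fun S α => α • ι U (conv T S.1)) = 0 := by
  choose a ha using fun S => GenNum.mk_surjective (l S)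
  obtain ⟨h1, h2⟩ := sum_smul_ι l.support a fun S => S.1
  obtain ⟨h3, h4⟩ := sum_smul_ι l.support a fun S => conv T S.1
  simp only [ha] at h2 h4
  rw [Finsupp.sum] at h ⊢
  rw [h2, GenFun.mk_eq_zero] at h
  rw [h4, GenFun.mk_eq_zero]
  exact negligible_conv T l.support (fun S => (a S).1) h

theorem spanConv_eq (T : Dist) (l : dPlus →₀ GenNum U) :
    spanConv T (l.sum fun S α => α • ι U S.1) = l.sum fun S α => α • ι U (conv T S.1) := by
  have h : ∃ l' : dPlus →₀ GenNum U, (l.sum fun S α => α • ι U S.1) =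
    l'.sum fun S α => α • ι U S.1 := ⟨l, rfl⟩
  rw [spanConv, dif_pos h]
  have h1 := h.choose_spec
  set l' := h.choose
  have h2 : ((l' - l).sum fun S α => α • ι U S.1) = 0 := by
    rw [Finsupp.sum_sub_index fun _ _ _ => sub_smul _ _ _, ← h1, sub_self]
  have h3 := spanConv_aux T _ h2
  rwa [Finsupp.sum_sub_index fun _ _ _ => sub_smul _ _ _, sub_eq_zero] at h3

theorem pair_lineDeriv (T : Dist) {f : ℝ → ℂ} (hf : IsTest f) :
    pair (∂_{(1 : ℝ)} T) f = -pair T (deriv f) := by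
  have hd : ∀ x, HasDerivAt f (deriv f x) x := fun x =>
    ((contDiff_infty_iff_deriv.1 hf.1).1 x).hasDerivAt
  have e1 : ∂_{(1 : ℝ)} (⟨fun x => (f x).re, hf.re.1, hf.re.2, Set.subset_univ _⟩ :
      𝓓((⊤ : Opens ℝ), ℝ)) =
      ⟨fun x => (deriv f x).re, hf.deriv.re.1, hf.deriv.re.2, Set.subset_univ _⟩ := by
    ext x
    rw [TestFunction.lineDerivOp_eq_lineDerivCLM (𝕜 := ℝ), TestFunction.lineDerivCLM_apply_of_le le_top]
    exact ((Complex.reCLM.hasFDerivAt.comp_hasDerivAt x (hd x)).hasFDerivAt.hasLineDerivAt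
      (1 : ℝ)).lineDeriv.trans (by simp)
  have e2 : ∂_{(1 : ℝ)} (⟨fun x => (f x).im, hf.im.1, hf.im.2, Set.subset_univ _⟩ :
      𝓓((⊤ : Opens ℝ), ℝ)) =
      ⟨fun x => (deriv f x).im, hf.deriv.im.1, hf.deriv.im.2, Set.subset_univ _⟩ := by
    ext x
    rw [TestFunction.lineDerivOp_eq_lineDerivCLM (𝕜 := ℝ), TestFunction.lineDerivCLM_apply_of_le le_top]
    exact ((Complex.imCLM.hasFDerivAt.comp_hasDerivAt x (hd x)).hasFDerivAt.hasLineDerivAt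
      (1 : ℝ)).lineDeriv.trans (by simp)
  rw [pair, pair, dif_pos hf, dif_pos hf.deriv, Distribution.lineDerivOp_apply_apply,
    Distribution.lineDerivOp_apply_apply, map_neg, map_neg, e1, e2]
  ring

theorem D_ι (T : Dist) : (ι U T).D = ι U (∂_{(1 : ℝ)} T) := by
  rw [ι, ι, GenFun.D_mk]
  congr 1
  ext φ x
  change deriv (reg T φ) x = reg (∂_{(1 : ℝ)} T) φ x
  rw [reg_eq_kern, (hasDerivAt_kern contDiff_const (by simp) (isTest_coe φ) x).deriv, kern, reg]
  have h := (isTest_coe φ).comp_affine (σ := -1) (by simp) x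
  have e : (fun y => φ (x - y)) = fun y => φ (x + -1 * y) := by
    ext y; congr 1; ring
  rw [e, pair_lineDeriv T h]
  have e2 : deriv (fun y => φ (x + -1 * y)) = fun y => -1 * (deriv φ (x + -1 * y)) := by
    ext y
    have := iteratedDeriv_comp_affine (isTest_coe φ).1 x (-1) y 1
    simpa using this
  rw [e2, pair_const_mul T (-1) ((isTest_coe φ).deriv.comp_affine (by simp) x)]
  simp

theorem D_add (f g : GenFun U) : (f + g).D = f.D + g.D := by
  obtain ⟨f, rfl⟩ := GenFun.mk_surjective f
  obtain ⟨g, rfl⟩ := GenFun.mk_surjective g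
  rw [← map_add, GenFun.D_mk, GenFun.D_mk, GenFun.D_mk, ← map_add]
  congr 1
  ext φ x
  exact deriv_add ((contDiff_infty_iff_deriv.1 (f.2.1 φ)).1 x)
    ((contDiff_infty_iff_deriv.1 (g.2.1 φ)).1 x)

theorem D_smul (a : GenNum U) (f : GenFun U) : (a • f).D = a • f.D := by
  obtain ⟨a, rfl⟩ := GenNum.mk_surjective a
  obtain ⟨f, rfl⟩ := GenFun.mk_surjective f
  rw [GenFun.D_mk, GenFun.mk_smul_mk, GenFun.mk_smul_mk, GenFun.D_mk]
  congr 1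
  ext φ x
  exact deriv_const_mul (a.1 φ) ((contDiff_infty_iff_deriv.1 (f.2.1 φ)).1 x)

theorem lineDeriv_mem_dPlus {T : Dist} (hT : T ∈ dPlus) : ∂_{(1 : ℝ)} T ∈ dPlus :=
  Distribution.IsVanishingOn.lineDerivOp hT 1

/-- The span of the distributions supported in `[0, ∞)` is closed under differentiation. -/
theorem D_mem_spanHat {f : GenFun U} (hf : f ∈ spanHat U dPlus) : f.D ∈ spanHat U dPlus := by
  have h0 : (0 : GenFun U).D = 0 := by
    have := D_smul (0 : GenNum U) (0 : GenFun U)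
    simpa using this
  induction hf using Submodule.span_induction with
  | mem x hx =>
    obtain ⟨T, hT, rfl⟩ := hx
    rw [D_ι]
    exact Submodule.subset_span ⟨_, lineDeriv_mem_dPlus hT, rfl⟩
  | zero => rw [h0]; exact Submodule.zero_mem _
  | add x y _ _ hx hy => rw [D_add]; exact Submodule.add_mem _ hx hy
  | smul a x _ hx => rw [D_smul]; exact Submodule.smul_mem _ a hx

/-! ### Regular distributions, the Dirac distribution, and the circuit -/

/-- The regular distribution with the (locally integrable) kernel `f`. -/
noncomputable def regular (f : ℝ → ℝ) : Dist :=
  (TestFunction.integralAgainstBilinCLM (ContinuousLinearMap.lsmul ℝ ℝ) volume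
    (fun t => (f t : ℂ)) : 𝓓((⊤ : Opens ℝ), ℝ) →L[ℝ] ℂ)

/-- The Dirac distribution at `0`. -/
noncomputable def diracDelta : Dist := Distribution.mapCLM Complex.ofRealCLM (Distribution.delta 0)

/-- The unit step function, the kernel of the Heaviside distribution. -/
noncomputable def step (t : ℝ) : ℝ := if 0 ≤ t then 1 else 0

/-- `I` solves the Kirchhoff problem `L I'' + R I' + I / C = V'`, `I(0) = 0`, `L I'(0) = 0`. -/
def IsCurrent (L R C : ℝ) (V I : GenFun U) : Prop :=
  L • I.D.D + R • I.D + (1 / C) • I = V.D ∧ I.eval 0 = 0 ∧ L • I.D.eval 0 = 0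

end

end SteadyState

namespace SteadyState

section

/-! The method is the classical one for linear equations with constant coefficients: a causal
fundamental solution yields a particular solution, homogeneous solutions correct the data at 0, and
a uniqueness theorem shows that nothing else solves the problem. The point is that each ingredient
survives in `GenFun`.

Particular solution. If a causal kernel `G` satisfies L G'' + R G' + G/C = δ, then G ⋆ V' solves the
equation: derivatives of a convolution may be moved onto the left factor (`lineDeriv_conv`,
`D_spanConv`), and δ is the unit of convolution on distributions supported in [0, ∞)
(`conv_diracDelta`). The equation for `G` follows from the jump formula (H f)' = f(0) δ + H f'
(`lineDeriv_regular_step`).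

Initial data. The correcting terms are ι of damped cosines, sines and exponentials, with generalized
numbers such as (G ⋆ V')(0) as coefficients. The initial conditions are equalities, so the values of
these functions at 0 must be exact and not merely infinitely close to the classical ones. This is
what the moment conditions give: they annihilate the nonconstant part of a Taylor polynomial, and
the remainder is of arbitrarily high order in the support radius (`isNegligibleNum_expMoment`).

Uniqueness. A generalized function with zero derivative that vanishes at 0 is zero, by the mean
value inequality (`eq_zero_of_D_eq_zero`). An integrating factor extends this to f' = l f with
complex l, and a second order operator factors over ℂ into two of first order
(`eq_zero_of_second_order`).

Values of the kernels. Against an even mollifier of integral 1, a kernel with a jump at 0 takes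
there the mean of its one-sided limits, up to an infinitesimal (`infClose_eval_ι_regular_step`). If
the smooth factor is even, the regularized value is exactly half of the regularized value of that
factor (`eval_ι_regular_step_even`). So the undamped kernel gives the equality ι(G₀')(0) = 1/2,
where the damped one is only shown to give ≈. -/

/-! ### Regular distributions and the jump formula. -/

theorem locallyIntegrable_step_mul {f : ℝ → ℝ} (hf : Continuous f) :
    LocallyIntegrable (fun t => step t * f t) volume := by
  have e : (fun t => step t * f t) = (Set.Ici (0 : ℝ)).indicator f := by
    ext t
    simp only [step, Set.indicator_apply, Set.mem_Ici, ite_mul, one_mul, zero_mul]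
  rw [e]
  exact hf.locallyIntegrable.indicator measurableSet_Ici

theorem integral_step_mul {E : Type*} [NormedAddCommGroup E] [NormedSpace ℝ E] (f : ℝ → E) :
    ∫ t, step t • f t = ∫ t in Set.Ioi 0, f t := by
  rw [← integral_Ici_eq_integral_Ioi, ← integral_indicator measurableSet_Ici]
  congr 1
  ext t
  simp only [step, Set.indicator_apply, Set.mem_Ici, ite_smul, one_smul, zero_smul]

theorem regular_apply {f : ℝ → ℝ} (hf : LocallyIntegrable f volume) (g : 𝓓((⊤ : Opens ℝ), ℝ)) :
    regular f g = ((∫ x, f x * g x : ℝ) : ℂ) := by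
  have h : LocallyIntegrableOn (fun t => (f t : ℂ)) ((⊤ : Opens ℝ) : Set ℝ) volume := by
    have : LocallyIntegrable (fun t => (f t : ℂ)) volume := fun x =>
      let ⟨s, hs, h⟩ := hf x; ⟨s, hs, h.ofReal⟩
    exact this.locallyIntegrableOn _
  refine (TestFunction.integralAgainstBilinCLM_eq_integral h).trans ?_
  refine Eq.trans ?_ integral_ofReal
  congr 1
  ext x
  simp [mul_comm]

theorem integrable_mul_test {f : ℝ → ℝ} (hf : LocallyIntegrable f volume) {h : ℝ → ℂ}
    (hc : Continuous h) (hs : HasCompactSupport h) : Integrable (fun x => (f x : ℂ) * h x) := by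
  have := LocallyIntegrable.integrable_smul_right_of_hasCompactSupport hf hc hs
  simpa using this

theorem pair_regular {f : ℝ → ℝ} (hf : LocallyIntegrable f volume) {h : ℝ → ℂ} (hh : IsTest h) :
    pair (regular f) h = ∫ y, (f y : ℂ) * h y := by
  have hi := integrable_mul_test hf hh.1.continuous hh.2
  rw [pair, dif_pos hh, regular_apply hf, regular_apply hf]
  apply Complex.ext
  · have := integral_re hi
    simp at this
    simp [← this]
  · have := integral_im hi
    simp at this
    simp [← this]

theorem lineDerivOp_testFn_apply (g : 𝓓((⊤ : Opens ℝ), ℝ)) (x : ℝ) :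
    (∂_{(1 : ℝ)} g : 𝓓((⊤ : Opens ℝ), ℝ)) x = deriv g x := by
  rw [TestFunction.lineDerivOp_eq_lineDerivCLM (𝕜 := ℝ),
    TestFunction.lineDerivCLM_apply_of_le le_top]
  have hd : DifferentiableAt ℝ g x := (contDiff_infty_iff_deriv.1 g.contDiff).1 x
  exact (hd.hasDerivAt.hasFDerivAt.hasLineDerivAt (1 : ℝ)).lineDeriv.trans (by simp)

theorem lineDeriv_apply (T : Dist) (g : 𝓓((⊤ : Opens ℝ), ℝ)) :
    (∂_{(1 : ℝ)} T) g = -T (∂_{(1 : ℝ)} g) := by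
  rw [Distribution.lineDerivOp_apply_apply, map_neg]

theorem diracDelta_apply (g : 𝓓((⊤ : Opens ℝ), ℝ)) : diracDelta g = (g 0 : ℂ) := rfl

theorem pair_diracDelta {h : ℝ → ℂ} (hh : IsTest h) : pair diracDelta h = h 0 := by
  rw [pair, dif_pos hh, diracDelta_apply, diracDelta_apply, mul_comm]
  exact Complex.re_add_im _

theorem contDiff_one_of_hasDerivAt {f f' : ℝ → ℝ} (hd : ∀ x, HasDerivAt f (f' x) x)
    (hc : Continuous f') : ContDiff ℝ 1 f := by
  rw [contDiff_one_iff_deriv]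
  refine ⟨fun x => (hd x).differentiableAt, ?_⟩
  rwa [show deriv f = f' from funext fun x => (hd x).deriv]

/-- Differentiation of a kernel with a jump at the origin. -/
theorem lineDeriv_regular_step {f f' : ℝ → ℝ} (hd : ∀ x, HasDerivAt f (f' x) x)
    (hc : Continuous f') :
    ∂_{(1 : ℝ)} (regular fun t => step t * f t) =
      f 0 • diracDelta + regular fun t => step t * f' t := by
  have hf := contDiff_one_of_hasDerivAt hd hc
  refine DFunLike.ext _ _ fun g => ?_
  have hg : ContDiff ℝ 1 g := g.contDiff.of_le (by exact_mod_cast le_top)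
  have hgd : ∀ x, HasDerivAt g (deriv g x) x := fun x =>
    (hg.differentiable one_ne_zero x).hasDerivAt
  have hs : HasCompactSupport g := g.hasCompactSupport
  have h1 : Integrable (fun x => f x * deriv g x) :=
    (hf.continuous.mul (hg.continuous_deriv le_rfl)).integrable_of_hasCompactSupport
      hs.deriv.mul_left
  have h2 : Integrable (fun x => f' x * g x) :=
    (hc.mul hg.continuous).integrable_of_hasCompactSupport hs.mul_left
  -- The product f g has compact support, so integrating (f g)' over (0, ∞) leaves only the boundary
  -- term -f(0) g(0). This is the source of the Dirac mass.
  have key := HasCompactSupport.integral_Ioi_deriv_eq (hf.mul hg) hs.mul_left 0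
  have e : deriv (fun x => f x * g x) = fun x => f' x * g x + f x * deriv g x := by
    ext x
    exact ((hd x).mul (hgd x)).deriv
  rw [e, integral_add h2.integrableOn h1.integrableOn] at key
  rw [lineDeriv_apply]
  change _ = f 0 • diracDelta g + regular (fun t => step t * f' t) g
  rw [diracDelta_apply, regular_apply (locallyIntegrable_step_mul hf.continuous),
    regular_apply (locallyIntegrable_step_mul hc)]
  simp only [lineDerivOp_testFn_apply, mul_assoc]
  have i1 := integral_step_mul (fun x => f x * deriv g x)
  have i2 := integral_step_mul (fun x => f' x * g x)
  simp only [smul_eq_mul] at i1 i2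
  rw [i1, i2, Complex.real_smul]
  rw [show (∫ x in Set.Ioi 0, f x * deriv g x) =
    -(f 0 * g 0) - ∫ x in Set.Ioi 0, f' x * g x by linarith]
  push_cast
  ring

theorem lineDeriv_regular {f f' : ℝ → ℝ} (hd : ∀ x, HasDerivAt f (f' x) x)
    (hc : Continuous f') : ∂_{(1 : ℝ)} (regular f) = regular f' := by
  have hf := contDiff_one_of_hasDerivAt hd hc
  refine DFunLike.ext _ _ fun g => ?_
  have hg : ContDiff ℝ 1 g := g.contDiff.of_le (by exact_mod_cast le_top)
  have hgd : ∀ x, HasDerivAt g (deriv g x) x := fun x =>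
    (hg.differentiable one_ne_zero x).hasDerivAt
  have hs : HasCompactSupport g := g.hasCompactSupport
  have h1 : Integrable (fun x => f x * deriv g x) :=
    (hf.continuous.mul (hg.continuous_deriv le_rfl)).integrable_of_hasCompactSupport
      hs.deriv.mul_left
  have h2 : Integrable (fun x => f' x * g x) :=
    (hc.mul hg.continuous).integrable_of_hasCompactSupport hs.mul_left
  have h3 : Integrable (fun x => f x * g x) :=
    (hf.continuous.mul hg.continuous).integrable_of_hasCompactSupport hs.mul_left
  have key := integral_mul_deriv_eq_deriv_mul_of_integrable (fun x _ => hd x)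
    (fun x _ => hgd x) h1 h2 h3
  rw [lineDeriv_apply, regular_apply hf.continuous.locallyIntegrable,
    regular_apply hc.locallyIntegrable]
  simp only [lineDerivOp_testFn_apply, key]
  push_cast
  ring

theorem regular_step_mem_dPlus {f : ℝ → ℝ} (hf : Continuous f) :
    regular (fun t => step t * f t) ∈ dPlus := by
  intro g hg
  rw [regular_apply (locallyIntegrable_step_mul hf)]
  have : ∀ x, step x * f x * g x = 0 := by
    intro x
    by_cases hx : 0 ≤ x
    · rw [image_eq_zero_of_notMem_tsupport (fun h => not_lt.2 hx (hg h)), mul_zero]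
    · rw [step, if_neg hx, zero_mul, zero_mul]
  simp [this]

theorem regular_const_mul (c : ℝ) {f : ℝ → ℝ} (hf : LocallyIntegrable f volume) :
    regular (fun t => c * f t) = c • regular f := by
  refine DFunLike.ext _ _ fun g => ?_
  change _ = c • regular f g
  have h : LocallyIntegrable (fun t => c * f t) volume := hf.smul c
  rw [regular_apply h, regular_apply hf, Complex.real_smul, ← Complex.ofReal_mul,
    ← integral_const_mul]
  simp only [mul_assoc]

theorem regular_add {f g : ℝ → ℝ} (hf : LocallyIntegrable f volume)
    (hg : LocallyIntegrable g volume) : regular (fun t => f t + g t) = regular f + regular g := by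
  refine DFunLike.ext _ _ fun h => ?_
  change _ = regular f h + regular g h
  have i : ∀ {f : ℝ → ℝ}, LocallyIntegrable f volume → Integrable (fun x => f x * h x) :=
    fun hf => hf.integrable_smul_right_of_hasCompactSupport h.contDiff.continuous
      h.hasCompactSupport
  rw [regular_apply (f := fun t => f t + g t) (hf.add hg), regular_apply hf, regular_apply hg, ← Complex.ofReal_add,
    ← integral_add (i hf) (i hg)]
  simp only [add_mul]

/-! ### Algebra of convolution: linearity on the left, the unit δ, differentiation. -/

theorem pair_add_left (T S : Dist) (f : ℝ → ℂ) : pair (T + S) f = pair T f + pair S f := by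
  by_cases h : IsTest f
  · rw [pair, pair, pair, dif_pos h, dif_pos h, dif_pos h]
    change T _ + S _ + Complex.I * (T _ + S _) = _
    ring
  · simp only [pair, dif_neg h, add_zero]

theorem pair_smul_left (c : ℝ) (T : Dist) (f : ℝ → ℂ) : pair (c • T) f = c * pair T f := by
  by_cases h : IsTest f
  · rw [pair, pair, dif_pos h, dif_pos h]
    change c • T _ + Complex.I * (c • T _) = _
    simp only [Complex.real_smul]
    ring
  · simp only [pair, dif_neg h, mul_zero]

theorem conv_add_left (T T' S : Dist) : conv (T + T') S = conv T S + conv T' S := by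
  refine DFunLike.ext _ _ fun f => ?_
  change _ = conv T S f + conv T' S f
  simp only [conv_apply, convPair, pair_add_left]

theorem conv_smul_left (c : ℝ) (T S : Dist) : conv (c • T) S = c • conv T S := by
  refine DFunLike.ext _ _ fun f => ?_
  change _ = c • conv T S f
  simp only [conv_apply, convPair, pair_smul_left, Complex.real_smul]

/-- A real test function is also a complex one with zero imaginary part, so the complex pairing
loses no information. Identities between distributions can then be proved with `pair`, for which the
kernel calculus is available. -/
theorem dist_ext {T S : Dist} (h : ∀ f, IsTest f → pair T f = pair S f) : T = S := by
  refine DFunLike.ext _ _ fun g => ?_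
  have key : ∀ T : Dist, pair T (fun x => (g x : ℂ)) = T g := by
    intro T
    rw [pair, dif_pos (isTest_ofReal g)]
    have e1 : (⟨fun x => ((g x : ℂ)).re, (isTest_ofReal g).re.1, (isTest_ofReal g).re.2,
        Set.subset_univ _⟩ : 𝓓((⊤ : Opens ℝ), ℝ)) = g := by ext x; rfl
    have e2 : (⟨fun x => ((g x : ℂ)).im, (isTest_ofReal g).im.1, (isTest_ofReal g).im.2,
        Set.subset_univ _⟩ : 𝓓((⊤ : Opens ℝ), ℝ)) = 0 := by ext x; rfl
    rw [e1, e2, map_zero, mul_zero, add_zero]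
  rw [← key, ← key]
  exact h _ (isTest_ofReal g)

/-- The outer cut-off is evaluated at 0, where it equals 1; the inner one is invisible to a
distribution supported in [0, ∞). -/
theorem conv_diracDelta {S : Dist} (hS : S ∈ dPlus) : conv diracDelta S = S := by
  refine dist_ext fun f hf => ?_
  rw [pair_conv _ _ hf, convPair_eq, pair_diracDelta (isTest_cutoff_kern S hf),
    cutoff_eq_one (by norm_num), one_mul, kern]
  simp only [zero_add, one_mul]
  exact pair_cutoff hS hf

/-- Differentiating η(x) ⟨S(y), η(y) f(x + y)⟩ in x gives the wanted term with f' plus one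
containing η'. The cut-off is constant on (-1, ∞), so η' vanishes there and `T` does not see the
extra term. -/
theorem lineDeriv_conv {T : Dist} (hT : T ∈ dPlus) (S : Dist) :
    ∂_{(1 : ℝ)} (conv T S) = conv (∂_{(1 : ℝ)} T) S := by
  refine dist_ext fun f hf => ?_
  have hk := fun x => hasDerivAt_kern (T := S) contDiff_cutoff (σ := 1) (by simp) hf x
  have hc : ∀ x, HasDerivAt cutoff (deriv cutoff x) x := fun x =>
    ((contDiff_infty_iff_deriv.1 contDiff_cutoff).1 x).hasDerivAt
  have e : deriv (fun x => cutoff x * kern S cutoff 1 f x) = fun x =>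
      deriv cutoff x * kern S cutoff 1 f x + cutoff x * kern S cutoff 1 (deriv f) x := by
    ext x
    exact ((hc x).mul (hk x)).deriv
  have t1 := isTest_cutoff_kern S hf
  have t2 := isTest_cutoff_kern S hf.deriv
  -- By the product rule `e` this function is the difference of two known test functions, which
  -- spares a direct support estimate.
  have t3 : IsTest (fun x => deriv cutoff x * kern S cutoff 1 f x) := by
    have := t1.deriv.add (t2.const_mul (-1))
    rw [e] at this
    convert this using 2
    ring
  have h0 : pair T (fun x => deriv cutoff x * kern S cutoff 1 f x) = 0 := by
    refine pair_eq_zero hT fun y hy => ?_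
    have : cutoff =ᶠ[𝓝 y] fun _ => 1 := by
      filter_upwards [lt_mem_nhds hy] with z hz
      exact cutoff_eq_one hz.le
    rw [this.deriv_eq]
    simp
  rw [pair_lineDeriv _ hf, pair_conv _ _ hf.deriv, pair_conv _ _ hf, convPair_eq, convPair_eq,
    pair_lineDeriv _ t1, e, pair_add T t3 t2, h0, zero_add]

/-! ### Transfer to generalized functions: linearity of ι and convolution on the span. -/

variable {U : DirectingUltrafilter}

theorem ι_add (T S : Dist) : ι U (T + S) = ι U T + ι U S := by
  rw [ι, ι, ι, ← map_add]
  congr 1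
  ext φ x
  exact pair_add_left T S _

theorem GenFun.mk_real_smul (c : ℝ) (f : moderateFun U) :
    GenFun.mk (c • f) = c • GenFun.mk f := rfl

theorem ι_smul (c : ℝ) (T : Dist) : ι U (c • T) = c • ι U T := by
  rw [ι, ι, ← GenFun.mk_real_smul]
  congr 1
  ext φ x
  exact (pair_smul_left c T _).trans Complex.real_smul.symm

/-- Brings an element of the span into the form on which `spanConv_eq` computes the convolution;
every rule for `spanConv` below starts here. -/
theorem exists_finsupp_of_mem_spanHat {f : GenFun U} (hf : f ∈ spanHat U dPlus) :
    ∃ l : dPlus →₀ GenNum U, (l.sum fun S α => α • ι U S.1) = f := by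
  rw [spanHat, Set.image_eq_range] at hf
  exact (Finsupp.mem_span_range_iff_exists_finsupp).1 hf

/-- Compatibility of two scalar actions. It provides the scalar tower below, through which real
coefficients of the equation can be mixed with generalized ones from the initial values. -/
theorem algebraMap_real_smul (c : ℝ) (f : GenFun U) :
    algebraMap ℝ (GenNum U) c • f = c • f := by
  obtain ⟨f, rfl⟩ := GenFun.mk_surjective f
  change GenFun.mk (constNet (algebraMap ℝ (moderateNum U) c) * f) = GenFun.mk (c • f)
  congr 1

instance : IsScalarTower ℝ (GenNum U) (GenFun U) :=
  IsScalarTower.of_algebraMap_eq fun c => by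
    have := algebraMap_real_smul (U := U) c 1
    rw [Algebra.algebraMap_eq_smul_one (R := ℝ) (A := GenFun U), ← this,
      Algebra.algebraMap_eq_smul_one (R := GenNum U) (A := GenFun U)]

theorem spanConv_add_left (T T' : Dist) {f : GenFun U} (hf : f ∈ spanHat U dPlus) :
    spanConv (T + T') f = spanConv T f + spanConv T' f := by
  obtain ⟨l, rfl⟩ := exists_finsupp_of_mem_spanHat hf
  rw [spanConv_eq, spanConv_eq, spanConv_eq, ← Finsupp.sum_add]
  simp only [conv_add_left, ι_add, smul_add]

theorem spanConv_smul_left (c : ℝ) (T : Dist) {f : GenFun U} (hf : f ∈ spanHat U dPlus) :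
    spanConv (c • T) f = c • spanConv T f := by
  obtain ⟨l, rfl⟩ := exists_finsupp_of_mem_spanHat hf
  rw [spanConv_eq, spanConv_eq, Finsupp.smul_sum]
  simp only [conv_smul_left, ι_smul, smul_comm c]

theorem spanConv_diracDelta {f : GenFun U} (hf : f ∈ spanHat U dPlus) :
    spanConv diracDelta f = f := by
  obtain ⟨l, rfl⟩ := exists_finsupp_of_mem_spanHat hf
  rw [spanConv_eq]
  simp only [conv_diracDelta (Subtype.prop _)]

theorem D_sum {κ : Type*} (s : Finset κ) (f : κ → GenFun U) :
    (∑ i ∈ s, f i).D = ∑ i ∈ s, (f i).D :=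
  map_sum (AddMonoidHom.mk' GenFun.D D_add) f s

theorem D_spanConv {T : Dist} (hT : T ∈ dPlus) {f : GenFun U} (hf : f ∈ spanHat U dPlus) :
    (spanConv T f).D = spanConv (∂_{(1 : ℝ)} T) f := by
  obtain ⟨l, rfl⟩ := exists_finsupp_of_mem_spanHat hf
  rw [spanConv_eq, spanConv_eq, Finsupp.sum, D_sum]
  simp only [D_smul, D_ι, lineDeriv_conv hT]
  rfl

/-! ### Uniqueness for linear equations with constant coefficients. -/

/-- Derivatives of positive order are derivatives of f', hence negligible. Order zero follows from
the mean value inequality on a ball around 0, starting from the negligible value at 0. -/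
theorem eq_zero_of_D_eq_zero {f : GenFun U} (h : f.D = 0) (h0 : f.eval 0 = 0) : f = 0 := by
  obtain ⟨f, rfl⟩ := GenFun.mk_surjective f
  rw [GenFun.D_mk, GenFun.mk_eq_zero] at h
  rw [GenFun.eval_mk, GenNum.mk_eq_zero] at h0
  rw [GenFun.mk_eq_zero]
  intro K hK k p
  cases k with
  | succ k =>
    filter_upwards [h K hK k p] with φ hφ x hx
    rw [iteratedDeriv_succ']
    exact hφ x hx
  | zero =>
    obtain ⟨X, hX⟩ := hK.isBounded.subset_closedBall 0
    -- The radius `X` may be negative if `K` is empty, hence |X|. One power of the support radius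
    -- beyond `p` is requested in order to absorb the factor |X| + 1 produced by the mean value
    -- inequality.
    filter_upwards [h _ (isCompact_closedBall 0 |X|) 0 (p + 1), h0 (p + 1),
      ae_le_inv U (|X| + 1), ae_radius_pos U] with φ h1 h2 h3 h4 x hx
    have hx' : x ∈ Metric.closedBall (0 : ℝ) |X| :=
      Metric.closedBall_subset_closedBall (le_abs_self X) (hX hx)
    have h5 : (|X| + 1) * supportRadius φ ≤ 1 := by
      rw [← le_div_iff₀ h4, one_div]; exact h3
    have h6 := Convex.norm_image_sub_le_of_norm_deriv_le (𝕜 := ℝ) (f := f.1 φ)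
      (fun y _ => (contDiff_infty_iff_deriv.1 (f.2.1 φ)).1 y)
      (fun y hy => by simpa [derivNet] using h1 y hy) (convex_closedBall 0 |X|)
      (x := 0) (y := x) (by simp) hx'
    rw [mem_closedBall_zero_iff] at hx'
    rw [sub_zero] at h6
    have h7 : ‖f.1 φ 0‖ ≤ supportRadius φ ^ (p + 1) := h2
    rw [iteratedDeriv_zero]
    calc ‖f.1 φ x‖ ≤ ‖f.1 φ x - f.1 φ 0‖ + ‖f.1 φ 0‖ := by
          simpa using norm_add_le (f.1 φ x - f.1 φ 0) (f.1 φ 0)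
      _ ≤ supportRadius φ ^ (p + 1) * |X| + supportRadius φ ^ (p + 1) := by
          refine add_le_add (h6.trans ?_) h7
          gcongr
      _ = ((|X| + 1) * supportRadius φ) * supportRadius φ ^ p := by ring
      _ ≤ 1 * supportRadius φ ^ p := by gcongr
      _ = _ := one_mul _

theorem D_mul (f g : GenFun U) : (f * g).D = f.D * g + f * g.D := by
  obtain ⟨f, rfl⟩ := GenFun.mk_surjective f
  obtain ⟨g, rfl⟩ := GenFun.mk_surjective g
  rw [← map_mul, GenFun.D_mk, GenFun.D_mk, GenFun.D_mk, ← map_mul, ← map_mul, ← map_add]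
  congr 1
  ext φ x
  exact deriv_mul ((contDiff_infty_iff_deriv.1 (f.2.1 φ)).1 x)
    ((contDiff_infty_iff_deriv.1 (g.2.1 φ)).1 x)

theorem D_complex_smul (c : ℂ) (f : GenFun U) : (c • f).D = c • f.D := by
  obtain ⟨f, rfl⟩ := GenFun.mk_surjective f
  change (GenFun.mk (c • f)).D = GenFun.mk (c • derivNet f)
  rw [GenFun.D_mk]
  congr 1
  ext φ x
  exact deriv_const_mul c ((contDiff_infty_iff_deriv.1 (f.2.1 φ)).1 x)

theorem D_real_smul (c : ℝ) (f : GenFun U) : (c • f).D = c • f.D := by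
  rw [← algebraMap_real_smul, D_smul, algebraMap_real_smul]

theorem D_sub (f g : GenFun U) : (f - g).D = f.D - g.D :=
  map_sub (AddMonoidHom.mk' GenFun.D D_add) f g

theorem D_neg (f : GenFun U) : (-f).D = -f.D :=
  map_neg (AddMonoidHom.mk' GenFun.D D_add) f

theorem eval_complex_smul (c : ℂ) (x : ℝ) (f : GenFun U) : (c • f).eval x = c • f.eval x := by
  obtain ⟨f, rfl⟩ := GenFun.mk_surjective f
  rfl

theorem eval_real_smul (c : ℝ) (x : ℝ) (f : GenFun U) : (c • f).eval x = c • f.eval x := by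
  obtain ⟨f, rfl⟩ := GenFun.mk_surjective f
  rfl

theorem eval_smul (a : GenNum U) (x : ℝ) (f : GenFun U) : (a • f).eval x = a * f.eval x := by
  obtain ⟨a, rfl⟩ := GenNum.mk_surjective a
  obtain ⟨f, rfl⟩ := GenFun.mk_surjective f
  rfl

theorem real_smul_eq_complex_smul (c : ℝ) (f : GenFun U) : c • f = (c : ℂ) • f := by
  obtain ⟨f, rfl⟩ := GenFun.mk_surjective f
  rfl

theorem contDiff_cexp_mul (l : ℂ) : ContDiff ℝ ∞ fun x : ℝ => Complex.exp (l * x) :=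
  (contDiff_const.mul Complex.ofRealCLM.contDiff).cexp

/-- On a compact set each derivative is bounded, and any fixed bound is eventually at most the
inverse support radius. The integrating factors are such constant nets, for which differentiation
and multiplication are literal; they need not be compared with the image of ι. -/
theorem isModerateFun_const {g : ℝ → ℂ} (hg : ContDiff ℝ ∞ g) :
    IsModerateFun U fun _ => g := by
  refine ⟨fun _ => hg, fun K hK k => ⟨1, ?_⟩⟩
  obtain ⟨B, hB⟩ := hK.exists_bound_of_continuousOn
    (hg.continuous_iteratedDeriv k (by exact_mod_cast le_top)).continuousOn
  filter_upwards [ae_le_inv U B] with φ h x hx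
  rw [pow_one]
  exact (hB x hx).trans h

variable (U) in
/-- The generalized function `exp (l x)`. -/
noncomputable def expFun (l : ℂ) : GenFun U :=
  GenFun.mk ⟨_, isModerateFun_const (contDiff_cexp_mul l)⟩

theorem D_expFun (l : ℂ) : (expFun U l).D = l • expFun U l := by
  change _ = GenFun.mk (l • _)
  rw [expFun, GenFun.D_mk]
  congr 1
  ext φ x
  have h : HasDerivAt (fun x : ℝ => Complex.exp (l * x)) (Complex.exp (l * x) * (l * 1)) x :=
    (Complex.ofRealCLM.hasDerivAt.const_mul l).cexp
  exact h.deriv.trans (by rw [mul_one, mul_comm]; rfl)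

theorem expFun_mul_expFun_neg (l : ℂ) : expFun U l * expFun U (-l) = 1 := by
  rw [expFun, expFun, ← map_mul, ← map_one GenFun.mk]
  congr 1
  ext φ x
  change Complex.exp (l * x) * Complex.exp (-l * x) = 1
  rw [← Complex.exp_add, neg_mul, add_neg_cancel, Complex.exp_zero]

/-- Integrating factor: e^(-l x) f has zero derivative and vanishes at 0, and the exponential is
invertible. Complex l is needed for the factorization of oscillating second order operators. -/
theorem eq_zero_of_D_eq_smul {l : ℂ} {f : GenFun U} (h : f.D = l • f) (h0 : f.eval 0 = 0) :
    f = 0 := by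
  have h1 : expFun U (-l) * f = 0 := by
    refine eq_zero_of_D_eq_zero ?_ ?_
    · rw [D_mul, D_expFun, h, neg_smul, neg_mul, smul_mul_assoc, mul_smul_comm, neg_add_cancel]
    · rw [map_mul, h0, mul_zero]
  rw [← one_mul f, ← expFun_mul_expFun_neg l, mul_assoc, h1, mul_zero]

/-- Uniqueness for homogeneous linear equations of first order. -/
theorem eq_zero_of_first_order {b c : ℝ} (hb : b ≠ 0) {f : GenFun U}
    (h : b • f.D + c • f = 0) (h0 : f.eval 0 = 0) : f = 0 := by
  refine eq_zero_of_D_eq_smul (l := ((-(c / b) : ℝ) : ℂ)) ?_ h0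
  rw [← real_smul_eq_complex_smul, ← inv_smul_smul₀ hb f.D, eq_neg_of_add_eq_zero_left h, smul_neg,
    smul_smul, neg_smul, div_eq_inv_mul]

/-- Uniqueness for homogeneous linear equations of second order. -/
theorem eq_zero_of_second_order {a b c : ℝ} (ha : a ≠ 0) {f : GenFun U}
    (h : a • f.D.D + b • f.D + c • f = 0) (h0 : f.eval 0 = 0) (h1 : f.D.eval 0 = 0) :
    f = 0 := by
  -- `z` is a square root of the discriminant, so `l` and `m` are the characteristic roots, possibly
  -- equal, and the operator is a (D - l)(D - m).
  obtain ⟨z, hz⟩ := IsAlgClosed.exists_pow_nat_eq ((b : ℂ) ^ 2 - 4 * a * c) zero_lt_two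
  have ha' : (a : ℂ) ≠ 0 := Complex.ofReal_ne_zero.2 ha
  set l : ℂ := (-b + z) / (2 * a) with hl
  set m : ℂ := (-b - z) / (2 * a) with hm
  have hs : (a : ℂ) * (l + m) = -b := by rw [hl, hm]; field_simp; ring
  have hp : (a : ℂ) * (l * m) = c := by
    rw [hl, hm]
    field_simp
    linear_combination -hz
  simp only [real_smul_eq_complex_smul] at h
  have e : (a : ℂ) • (f.D.D - (l + m) • f.D + (l * m) • f) = 0 := by
    rw [smul_add, smul_sub, smul_smul, smul_smul, hs, hp, neg_smul, sub_neg_eq_add]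
    exact h
  have e' := (smul_eq_zero_iff_right ha').1 e
  -- Peels off the two factors: h = f' - m f satisfies h' = l h and h(0) = 0, so h = 0; then f' = m
  -- f with f(0) = 0.
  refine eq_zero_of_D_eq_smul (l := m) (sub_eq_zero.1 ?_) h0
  refine eq_zero_of_D_eq_smul (l := l) ?_ ?_
  · rw [D_sub, D_complex_smul, ← sub_eq_zero, ← e', smul_sub, smul_smul, add_smul]
    abel
  · rw [map_sub, eval_complex_smul, h0, h1, smul_zero, sub_zero]

/-! ### Values at the origin of embedded functions and kernels. -/

theorem norm_integral_mul_le {n : ℕ} (hn : 1 ≤ n) {φ : TestFn} (hφ : φ ∈ directing n)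
    {f : ℝ → ℂ} {B : ℝ} (hB : 0 ≤ B) (hf : ∀ y, |y| ≤ supportRadius φ → ‖f y‖ ≤ B) :
    ‖∫ y, f y * φ y‖ ≤ 2 * B := by
  have hi : Integrable fun y => ‖φ y‖ :=
    (φ.contDiff.continuous.integrable_of_hasCompactSupport φ.hasCompactSupport).norm
  -- The factor 2 is a crude bound for 1 + 1/n with n ≥ 1.
  have h1 : ∫ y, ‖φ y‖ ≤ 2 := by
    have h2 : (1 : ℝ) ≤ n := by exact_mod_cast hn
    have h3 : 1 / (n : ℝ) ≤ 1 := by rw [div_le_one (by linarith)]; exact h2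
    linarith [hφ.2.2.2.2.2.1]
  calc ‖∫ y, f y * φ y‖ ≤ ∫ y, B * ‖φ y‖ := by
        refine norm_integral_le_of_norm_le (hi.const_mul B) (Eventually.of_forall fun y => ?_)
        rw [norm_mul]
        by_cases h0 : φ y = 0
        · simp [h0]
        · gcongr
          exact hf y (abs_le_supportRadius h0)
    _ = B * ∫ y, ‖φ y‖ := integral_const_mul _ _
    _ ≤ 2 * B := by rw [mul_comm]; gcongr

theorem integrable_mul_coe {f : ℝ → ℂ} (hf : Continuous f) (φ : TestFn) :
    Integrable fun y => f y * φ y :=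
  (hf.mul φ.contDiff.continuous).integrable_of_hasCompactSupport φ.hasCompactSupport.mul_left

/-- By the moment conditions, the exponential moments of the mollifiers are negligibly close
to `1`. -/
theorem isNegligibleNum_expMoment (l : ℂ) :
    IsNegligibleNum U fun φ => (∫ y : ℝ, Complex.exp (l * y) * φ y) - 1 := by
  intro p
  filter_upwards [ae_directing U (p + 1) (by omega), ae_radius_pos U,
    ae_le_inv U (2 * (‖l‖ ^ (p + 2) * Real.exp ‖l‖)), ae_le_inv U 1] with φ h1 h2 h3 h4
  have hR : supportRadius φ ≤ 1 := by
    rw [← inv_inv (supportRadius φ)]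
    exact inv_le_one_of_one_le₀ h4
  have hpoly : ∀ k : ℕ, Integrable fun y : ℝ => ((l * y) ^ k / (k.factorial : ℂ)) * φ y :=
    fun k => integrable_mul_coe (by fun_prop) φ
  -- Membership in `directing (p + 1)` annihilates the moments of orders 1 to p + 1, which are
  -- exactly the nonconstant terms of the Taylor polynomial of degree p + 1. The constant term
  -- contributes the integral of φ.
  have e1 : ∫ y : ℝ, (∑ k ∈ Finset.range (p + 2), (l * y) ^ k / (k.factorial : ℂ)) * φ y = 1 := by
    simp only [Finset.sum_mul]
    rw [integral_finsetSum _ fun k _ => hpoly k, Finset.sum_range_succ']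
    have e2 : ∀ k ∈ Finset.range (p + 1),
        ∫ y : ℝ, (l * y) ^ (k + 1) / ((k + 1).factorial : ℂ) * φ y = 0 := by
      intro k hk
      have e3 : (fun y : ℝ => (l * y) ^ (k + 1) / ((k + 1).factorial : ℂ) * φ y) =
          fun y : ℝ => (l ^ (k + 1) / ((k + 1).factorial : ℂ)) * ((y : ℂ) ^ (k + 1) * φ y) := by
        ext y
        rw [mul_pow]
        ring
      rw [e3, integral_const_mul, h1.2.2.2.2.1 (k + 1) (by omega)
        (by have := Finset.mem_range.1 hk; omega), mul_zero]
    rw [Finset.sum_eq_zero e2]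
    simpa using h1.2.2.2.1
  -- Writing 1 as the integral of the Taylor polynomial against φ leaves only the Taylor remainder,
  -- of order p + 2 in the support radius.
  rw [← e1, ← integral_sub (integrable_mul_coe (by fun_prop) φ)
    (integrable_mul_coe (by fun_prop) φ)]
  simp only [← sub_mul]
  have hb := norm_integral_mul_le (by omega) h1 (f := fun y : ℝ => Complex.exp (l * y) -
    ∑ k ∈ Finset.range (p + 2), (l * y) ^ k / (k.factorial : ℂ))
    (B := ‖l‖ ^ (p + 2) * Real.exp ‖l‖ * supportRadius φ ^ (p + 2)) (by positivity) ?_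
  · refine hb.trans ?_
    -- Of the two spare powers of the support radius, one absorbs the constant; the other is bounded
    -- by 1.
    have h5 : 2 * (‖l‖ ^ (p + 2) * Real.exp ‖l‖) * supportRadius φ ≤ 1 := by
      rw [← le_div_iff₀ h2, one_div]; exact h3
    calc _ = (2 * (‖l‖ ^ (p + 2) * Real.exp ‖l‖) * supportRadius φ) *
          (supportRadius φ * supportRadius φ ^ p) := by ring
      _ ≤ 1 * (1 * supportRadius φ ^ p) := by gcongr
      _ = _ := by ring
  · intro y hy
    refine (Complex.norm_exp_sub_sum_le_norm_mul_exp _ _).trans ?_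
    have hly : ‖l * (y : ℂ)‖ ≤ ‖l‖ * supportRadius φ := by
      rw [norm_mul, Complex.norm_real, Real.norm_eq_abs]
      gcongr
    have hly' : ‖l * (y : ℂ)‖ ≤ ‖l‖ := hly.trans (mul_le_of_le_one_right (norm_nonneg _) hR)
    calc _ ≤ (‖l‖ * supportRadius φ) ^ (p + 2) * Real.exp ‖l‖ := by gcongr
      _ = _ := by rw [mul_pow]; ring

/-- Evenness of φ removes the reflection in the convolution. -/
theorem reg_regular_zero {f : ℝ → ℝ} (hf : LocallyIntegrable f volume) {n : ℕ} {φ : TestFn}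
    (hφ : φ ∈ directing n) : reg (regular f) φ 0 = ∫ y, (f y : ℂ) * φ y := by
  have h : IsTest fun y => φ (0 - y) := by
    have := (isTest_coe φ).comp_affine (σ := -1) (by simp) 0
    convert this using 3
    ring
  rw [reg, pair_regular hf h]
  simp only [zero_sub, hφ.2.1]

theorem eval_ι_regular_eq {f : ℝ → ℝ} (hf : LocallyIntegrable f volume) {c : ℝ}
    (h : IsNegligibleNum U fun φ => (∫ y, (f y : ℂ) * φ y) - c) :
    (ι U (regular f)).eval 0 = algebraMap ℝ (GenNum U) c := by
  rw [ι, GenFun.eval_mk, ← sub_eq_zero]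
  change GenNum.mk (_ - algebraMap ℝ (moderateNum U) c) = 0
  rw [GenNum.mk_eq_zero]
  intro p
  filter_upwards [h p, ae_directing U 1 le_rfl] with φ h1 h2
  rw [← reg_regular_zero hf h2] at h1
  exact h1

/-- Two exponentials are all that is needed: damped cosines and sines are such combinations by
Euler's formulas, and a single exponential is one with b = 0. Since `f` is real, c = f(0). -/
theorem isNegligibleNum_add_expMoment {f : ℝ → ℝ} {a b l m : ℂ} {c : ℝ}
    (h : ∀ y : ℝ, (f y : ℂ) = a * Complex.exp (l * y) + b * Complex.exp (m * y))
    (hc : a + b = c) : IsNegligibleNum U fun φ => (∫ y, (f y : ℂ) * φ y) - c := by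
  intro p
  filter_upwards [isNegligibleNum_expMoment l (p + 1), isNegligibleNum_expMoment m (p + 1),
    ae_le_inv U (‖a‖ + ‖b‖), ae_radius_pos U] with φ h1 h2 h3 h4
  have h5 : (‖a‖ + ‖b‖) * supportRadius φ ≤ 1 := by
    rw [← le_div_iff₀ h4, one_div]; exact h3
  have e : (∫ y, (f y : ℂ) * φ y) - c = a * ((∫ y : ℝ, Complex.exp (l * y) * φ y) - 1) +
      b * ((∫ y : ℝ, Complex.exp (m * y) * φ y) - 1) := by
    have i1 := (integrable_mul_coe (f := fun y : ℝ => Complex.exp (l * y)) (by fun_prop) φ)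
    have i2 := (integrable_mul_coe (f := fun y : ℝ => Complex.exp (m * y)) (by fun_prop) φ)
    simp only [h, add_mul, mul_assoc]
    rw [integral_add (i1.const_mul a) (i2.const_mul b), integral_const_mul, integral_const_mul,
      ← hc]
    ring
  rw [e]
  calc _ ≤ ‖a‖ * supportRadius φ ^ (p + 1) + ‖b‖ * supportRadius φ ^ (p + 1) := by
        refine (norm_add_le _ _).trans ?_
        rw [norm_mul, norm_mul]
        gcongr
    _ = ((‖a‖ + ‖b‖) * supportRadius φ) * supportRadius φ ^ p := by ring
    _ ≤ 1 * supportRadius φ ^ p := by gcongr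
    _ = _ := one_mul _

theorem isNegligibleNum_exp (a : ℝ) :
    IsNegligibleNum U fun φ => (∫ y, ((Real.exp (a * y) : ℝ) : ℂ) * φ y) - (1 : ℝ) :=
  isNegligibleNum_add_expMoment (f := fun y => Real.exp (a * y)) (a := 1) (b := 0) (l := a) (m := 0)
    (fun y => by push_cast; ring) (by simp)

theorem isNegligibleNum_exp_mul_cos (a w : ℝ) :
    IsNegligibleNum U fun φ =>
      (∫ y, ((Real.exp (a * y) * Real.cos (w * y) : ℝ) : ℂ) * φ y) - (1 : ℝ) := by
  refine isNegligibleNum_add_expMoment (f := fun y => Real.exp (a * y) * Real.cos (w * y))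
    (a := 1 / 2) (b := 1 / 2) (l := a + w * Complex.I) (m := a - w * Complex.I) (fun y => ?_)
    (by norm_num)
  push_cast
  rw [Complex.cos, add_mul, sub_mul, sub_eq_add_neg, Complex.exp_add, Complex.exp_add]
  ring_nf

theorem isNegligibleNum_exp_mul_sin (a w : ℝ) :
    IsNegligibleNum U fun φ =>
      (∫ y, ((Real.exp (a * y) * Real.sin (w * y) : ℝ) : ℂ) * φ y) - (0 : ℝ) := by
  refine isNegligibleNum_add_expMoment (f := fun y => Real.exp (a * y) * Real.sin (w * y))
    (a := -Complex.I / 2) (b := Complex.I / 2) (l := a + w * Complex.I) (m := a - w * Complex.I)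
    (fun y => ?_) (by push_cast; ring)
  push_cast
  have h1 : (a + w * Complex.I : ℂ) * y = a * y + w * y * Complex.I := by ring
  have h2 : (a - w * Complex.I : ℂ) * y = a * y + -(w * y) * Complex.I := by ring
  rw [Complex.sin, h1, h2, Complex.exp_add, Complex.exp_add]
  ring

/-- The reflection y ↦ -y exchanges the two half-lines, so each carries half of the integral. -/
theorem integral_step_mul_even {f : ℝ → ℂ} (hi : Integrable f) (he : ∀ x, f (-x) = f x) :
    ∫ y, (step y : ℂ) * f y = 1 / 2 * ∫ y, f y := by
  have h1 := integral_step_mul f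
  simp only [Complex.real_smul] at h1
  have h2 := integral_comp_neg_Iic (0 : ℝ) f
  simp only [he, neg_zero] at h2
  rw [h1, ← intervalIntegral.integral_Iic_add_Ioi hi.integrableOn hi.integrableOn (b := 0), h2]
  ring

/-- With both f and φ even, cutting off at 0 halves the integral of f φ exactly, so a negligible
error stays negligible. The result is an equality and not only infinite closeness. -/
theorem eval_ι_regular_step_even {f : ℝ → ℝ} (hf : Continuous f) (he : ∀ x, f (-x) = f x) {c : ℝ}
    (h : IsNegligibleNum U fun φ => (∫ y, (f y : ℂ) * φ y) - c) :
    (ι U (regular fun t => step t * f t)).eval 0 = algebraMap ℝ (GenNum U) (c / 2) := by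
  refine eval_ι_regular_eq (locallyIntegrable_step_mul hf) fun p => ?_
  filter_upwards [h p, ae_directing U 1 le_rfl, ae_radius_pos U] with φ h1 h2 h3
  have e := integral_step_mul_even (f := fun y => (f y : ℂ) * φ y)
    (integrable_mul_coe (by fun_prop) φ) fun y => by rw [he, h2.2.1]
  simp only [Complex.ofReal_mul, mul_assoc]
  rw [e]
  calc _ = ‖(1 / 2 : ℂ) * ((∫ y, (f y : ℂ) * φ y) - c)‖ := by
        congr 1; push_cast; ring
    _ = 1 / 2 * ‖(∫ y, (f y : ℂ) * φ y) - c‖ := by rw [norm_mul]; norm_num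
    _ ≤ 1 * supportRadius φ ^ p := by gcongr; norm_num
    _ = _ := one_mul _

/-- The value at the origin of a kernel with a jump is infinitely close to the mean of the
one-sided limits. -/
theorem infClose_eval_ι_regular_step {f : ℝ → ℝ} (hf : Continuous f) :
    InfClose ((ι U (regular fun t => step t * f t)).eval 0)
      (algebraMap ℝ (GenNum U) (f 0 / 2)) := by
  intro n hn
  have hn0 : (0 : ℝ) < n := by exact_mod_cast hn
  refine ⟨evalNet 0 ⟨_, isModerateFun_reg U (regular fun t => step t * f t)⟩ -
    algebraMap ℝ (moderateNum U) (f 0 / 2), rfl, ?_⟩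
  -- The tolerance 1/(4n) is doubled by `norm_integral_mul_le`, and 1/(2n) is strictly below 1/n.
  -- The bound 2/δ required next keeps the support of φ within δ/2 of the origin.
  obtain ⟨δ, hδ, hfδ⟩ := Metric.continuousAt_iff.1 hf.continuousAt (1 / (4 * n)) (by positivity)
  filter_upwards [ae_directing U 1 le_rfl, ae_radius_pos U, ae_le_inv U (2 / δ)] with φ h1 h2 h3
  have hRδ : supportRadius φ < δ := by
    rw [div_le_iff₀ hδ, inv_mul_eq_div, le_div_iff₀ h2] at h3
    linarith
  change ‖reg (regular fun t => step t * f t) φ 0 - ((f 0 / 2 : ℝ) : ℂ)‖ < _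
  rw [reg_regular_zero (locallyIntegrable_step_mul hf) h1]
  have hφi := φ.contDiff.continuous.integrable_of_hasCompactSupport φ.hasCompactSupport
    (μ := volume)
  have e1 := integral_step_mul_even hφi h1.2.1
  rw [h1.2.2.2.1] at e1
  have i1 := integrable_mul_test (locallyIntegrable_step_mul hf) φ.contDiff.continuous
    φ.hasCompactSupport
  have i2 := integrable_mul_test (locallyIntegrable_step_mul (continuous_const (y := f 0)))
    φ.contDiff.continuous φ.hasCompactSupport
  -- Half of the mass of φ lies on the positive side. Thus f(0)/2 is the value for the constant
  -- factor f(0), and only the oscillation of f near 0 remains to be estimated.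
  have e2 : ((f 0 / 2 : ℝ) : ℂ) = ∫ y, ((step y * f 0 : ℝ) : ℂ) * φ y := by
    have : (fun y => ((step y * f 0 : ℝ) : ℂ) * φ y) =
        fun y => (f 0 : ℂ) * ((step y : ℂ) * φ y) := by
      ext y; push_cast; ring
    rw [this, integral_const_mul, e1]
    push_cast
    ring
  rw [e2, ← integral_sub i1 i2]
  simp only [← sub_mul]
  refine (norm_integral_mul_le le_rfl h1 (B := 1 / (4 * n)) (by positivity) ?_).trans_lt ?_
  · intro y hy
    rw [← Complex.ofReal_sub, ← mul_sub, Complex.norm_real, norm_mul]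
    have h4 := (hfδ (x := y) (by rw [Real.dist_eq, sub_zero]; linarith)).le
    rw [Real.dist_eq] at h4
    refine (mul_le_of_le_one_left (norm_nonneg _) ?_).trans h4
    rw [step]
    split_ifs <;> simp
  · rw [← mul_div_assoc, div_lt_div_iff₀ (by positivity) hn0]
    linarith

/-! ### The damped oscillations and their causal kernels. -/

/-- The causal kernel `H(t) exp (-a t) cos (w t)`. -/
noncomputable def causalCos (a w : ℝ) : Dist :=
  regular fun t => step t * Real.exp (-(a * t)) * Real.cos (w * t)

/-- The causal kernel `H(t) exp (-a t) sin (w t)`. -/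
noncomputable def causalSin (a w : ℝ) : Dist :=
  regular fun t => step t * Real.exp (-(a * t)) * Real.sin (w * t)

/-- The smooth function `exp (-a t) cos (w t)`. -/
noncomputable def dampedCos (a w : ℝ) : Dist :=
  regular fun t => Real.exp (-(a * t)) * Real.cos (w * t)

/-- The smooth function `exp (-a t) sin (w t)`. -/
noncomputable def dampedSin (a w : ℝ) : Dist :=
  regular fun t => Real.exp (-(a * t)) * Real.sin (w * t)

theorem hasDerivAt_exp_neg_mul (a t : ℝ) :
    HasDerivAt (fun t => Real.exp (-(a * t))) (-a * Real.exp (-(a * t))) t := by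
  have h := ((hasDerivAt_id t).const_mul a).neg.exp
  refine h.congr_deriv ?_
  simp [mul_comm]

theorem hasDerivAt_exp_mul_cos (a w t : ℝ) :
    HasDerivAt (fun t => Real.exp (-(a * t)) * Real.cos (w * t))
      (-a * (Real.exp (-(a * t)) * Real.cos (w * t)) +
        -w * (Real.exp (-(a * t)) * Real.sin (w * t))) t := by
  refine ((hasDerivAt_exp_neg_mul a t).mul ((hasDerivAt_id t).const_mul w).cos).congr_deriv ?_
  simp only [id]
  ring

theorem hasDerivAt_exp_mul_sin (a w t : ℝ) :
    HasDerivAt (fun t => Real.exp (-(a * t)) * Real.sin (w * t))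
      (-a * (Real.exp (-(a * t)) * Real.sin (w * t)) +
        w * (Real.exp (-(a * t)) * Real.cos (w * t))) t := by
  refine ((hasDerivAt_exp_neg_mul a t).mul ((hasDerivAt_id t).const_mul w).sin).congr_deriv ?_
  simp only [id]
  ring

theorem continuous_exp_mul_cos (a w : ℝ) :
    Continuous fun t => Real.exp (-(a * t)) * Real.cos (w * t) := by fun_prop

theorem continuous_exp_mul_sin (a w : ℝ) :
    Continuous fun t => Real.exp (-(a * t)) * Real.sin (w * t) := by fun_prop

theorem regular_combination (a b : ℝ) {f g : ℝ → ℝ} (hf : LocallyIntegrable f volume)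
    (hg : LocallyIntegrable g volume) :
    regular (fun t => a * f t + b * g t) = a • regular f + b • regular g := by
  rw [← regular_const_mul a hf, ← regular_const_mul b hg]
  exact regular_add (hf.smul a) (hg.smul b)

theorem lineDeriv_dampedCos (a w : ℝ) :
    ∂_{(1 : ℝ)} (dampedCos a w) = -a • dampedCos a w + -w • dampedSin a w := by
  rw [dampedCos, lineDeriv_regular (hasDerivAt_exp_mul_cos a w) (by fun_prop),
    regular_combination _ _ (continuous_exp_mul_cos a w).locallyIntegrable
      (continuous_exp_mul_sin a w).locallyIntegrable]
  rfl

theorem lineDeriv_dampedSin (a w : ℝ) :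
    ∂_{(1 : ℝ)} (dampedSin a w) = -a • dampedSin a w + w • dampedCos a w := by
  rw [dampedSin, lineDeriv_regular (hasDerivAt_exp_mul_sin a w) (by fun_prop),
    regular_combination _ _ (continuous_exp_mul_sin a w).locallyIntegrable
      (continuous_exp_mul_cos a w).locallyIntegrable]
  rfl

theorem causalCos_eq (a w : ℝ) : causalCos a w =
    regular fun t => step t * (Real.exp (-(a * t)) * Real.cos (w * t)) := by
  simp only [causalCos, mul_assoc]

theorem causalSin_eq (a w : ℝ) : causalSin a w =
    regular fun t => step t * (Real.exp (-(a * t)) * Real.sin (w * t)) := by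
  simp only [causalSin, mul_assoc]

theorem regular_step_combination (a b : ℝ) {f g : ℝ → ℝ} (hf : Continuous f)
    (hg : Continuous g) :
    regular (fun t => step t * (a * f t + b * g t)) =
      a • regular (fun t => step t * f t) + b • regular fun t => step t * g t := by
  rw [← regular_combination _ _ (locallyIntegrable_step_mul hf) (locallyIntegrable_step_mul hg)]
  congr 1
  ext t
  ring

theorem lineDeriv_causalCos (a w : ℝ) :
    ∂_{(1 : ℝ)} (causalCos a w) = diracDelta + (-a • causalCos a w + -w • causalSin a w) := by
  rw [causalCos_eq, causalSin_eq, lineDeriv_regular_step (hasDerivAt_exp_mul_cos a w) (by fun_prop),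
    regular_step_combination _ _ (continuous_exp_mul_cos a w) (continuous_exp_mul_sin a w)]
  simp

theorem lineDeriv_causalSin (a w : ℝ) :
    ∂_{(1 : ℝ)} (causalSin a w) = -a • causalSin a w + w • causalCos a w := by
  rw [causalCos_eq, causalSin_eq, lineDeriv_regular_step (hasDerivAt_exp_mul_sin a w) (by fun_prop),
    regular_step_combination _ _ (continuous_exp_mul_sin a w) (continuous_exp_mul_cos a w)]
  simp
  -- The sine vanishes at 0, so its causal kernel has no jump and no Dirac mass appears.
  exact zero_smul ℝ diracDelta

theorem causalSin_mem_dPlus (a w : ℝ) : causalSin a w ∈ dPlus := by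
  rw [causalSin_eq]
  exact regular_step_mem_dPlus (continuous_exp_mul_sin a w)

theorem smul_mem_dPlus (c : ℝ) {T : Dist} (hT : T ∈ dPlus) : c • T ∈ dPlus := by
  intro g hg
  change c • T g = 0
  rw [hT g hg, smul_zero]


/-- An exact equality of generalized numbers, by the moment conditions. With its counterpart for the
sine it makes the initial conditions hold exactly. -/
theorem eval_ι_dampedCos (a w : ℝ) : (ι U (dampedCos a w)).eval 0 = 1 := by
  rw [dampedCos, ← map_one (algebraMap ℝ (GenNum U))]
  refine eval_ι_regular_eq (continuous_exp_mul_cos a w).locallyIntegrable ?_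
  simpa only [neg_mul] using isNegligibleNum_exp_mul_cos (-a) w

theorem eval_ι_dampedSin (a w : ℝ) : (ι U (dampedSin a w)).eval 0 = 0 := by
  rw [dampedSin, ← map_zero (algebraMap ℝ (GenNum U))]
  refine eval_ι_regular_eq (continuous_exp_mul_sin a w).locallyIntegrable ?_
  simpa only [neg_mul] using isNegligibleNum_exp_mul_sin (-a) w

theorem infClose_causalSin (a w c : ℝ) : InfClose ((ι U (c • causalSin a w)).eval 0) 0 := by
  have h := infClose_eval_ι_regular_step (U := U)
    (f := fun t => c * (Real.exp (-(a * t)) * Real.sin (w * t))) (by fun_prop)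
  have e : regular (fun t => step t * (c * (Real.exp (-(a * t)) * Real.sin (w * t)))) =
      c • causalSin a w := by
    rw [causalSin_eq,
      ← regular_const_mul c (locallyIntegrable_step_mul (continuous_exp_mul_sin a w))]
    simp only [mul_left_comm]
  rw [e] at h
  simpa using h

/-- The combination jumps from 0 to c at the origin: the sine contributes nothing there and the
cosine contributes its coefficient. It is treated as one kernel so that a single application of the
mean value rule suffices. -/
theorem infClose_combination (a w b c : ℝ) :
    InfClose ((ι U (b • causalSin a w + c • causalCos a w)).eval 0)
      (algebraMap ℝ (GenNum U) (c / 2)) := by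
  have h := infClose_eval_ι_regular_step (U := U)
    (f := fun t => b * (Real.exp (-(a * t)) * Real.sin (w * t)) +
      c * (Real.exp (-(a * t)) * Real.cos (w * t))) (by fun_prop)
  rw [regular_step_combination _ _ (continuous_exp_mul_sin a w) (continuous_exp_mul_cos a w),
    ← causalSin_eq, ← causalCos_eq] at h
  simpa using h

/-! ### Solution formulas and fundamental solutions. -/

/-- The differential operator `a f'' + b f' + c f`, linear over the generalized numbers. -/
noncomputable def diffOp (a b c : ℝ) : GenFun U →ₗ[GenNum U] GenFun U where
  toFun f := a • f.D.D + b • f.D + c • f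
  map_add' f g := by
    simp only [D_add, smul_add]
    abel
  map_smul' x f := by
    simp only [D_smul, smul_add, smul_comm x, RingHom.id_apply]

theorem diffOp_apply (a b c : ℝ) (f : GenFun U) :
    diffOp a b c f = a • f.D.D + b • f.D + c • f := rfl

/-- Subtracting P(0) E from a particular solution P corrects the value at 0 without changing the
right-hand side; uniqueness does the rest. Since P(0) is a generalized number, the operator must be
linear over `GenNum`. -/
theorem first_order_solution_iff {b c : ℝ} (hb : b ≠ 0) {F P E : GenFun U}
    (hP : b • P.D + c • P = F) (hE : b • E.D + c • E = 0) (hE0 : E.eval 0 = 1) (f : GenFun U) :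
    (b • f.D + c • f = F ∧ f.eval 0 = 0) ↔ f = P - P.eval 0 • E := by
  have e : ∀ f : GenFun U, b • f.D + c • f = diffOp 0 b c f := fun f => by
    rw [diffOp_apply, zero_smul, zero_add]
  rw [e] at hP hE ⊢
  have h1 : diffOp 0 b c (P - P.eval 0 • E) = F := by
    rw [map_sub, map_smul, hP, hE, smul_zero, sub_zero]
  have h2 : (P - P.eval 0 • E).eval 0 = 0 := by
    rw [map_sub, eval_smul, hE0, mul_one, sub_self]
  refine ⟨fun ⟨h3, h4⟩ => ?_, fun h => h ▸ ⟨h1, h2⟩⟩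
  refine sub_eq_zero.1 (eq_zero_of_first_order hb (c := c) ?_ ?_)
  · rw [e, map_sub, h3, h1, sub_self]
  · rw [map_sub, h4, h2, sub_self]

/-- The hypotheses say that the characteristic roots are -a ± i w, so the damped cosine and sine
solve the homogeneous equation. They are fitted to cancel the value and the derivative of P at 0. -/
theorem second_order_solution_iff {L R c a w : ℝ} (hL : L ≠ 0) (hw : w ≠ 0) (hR : R = 2 * L * a)
    (hc : c = L * (a ^ 2 + w ^ 2)) {F P : GenFun U} (hP : L • P.D.D + R • P.D + c • P = F)
    (f : GenFun U) :
    (L • f.D.D + R • f.D + c • f = F ∧ f.eval 0 = 0 ∧ f.D.eval 0 = 0) ↔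
      f = -(P.eval 0 • ι U (dampedCos a w)) -
        ((a / w) • P.eval 0 + (1 / w) • P.D.eval 0) • ι U (dampedSin a w) + P := by
  set A := ι U (dampedCos a w) with hA
  set B := ι U (dampedSin a w) with hB
  have hA' : A.D = -a • A + -w • B := by
    rw [hA, D_ι, lineDeriv_dampedCos, ι_add, ι_smul, ι_smul]
  have hB' : B.D = -a • B + w • A := by
    rw [hB, D_ι, lineDeriv_dampedSin, ι_add, ι_smul, ι_smul]
  have hA0 : A.eval 0 = 1 := eval_ι_dampedCos a w
  have hB0 : B.eval 0 = 0 := eval_ι_dampedSin a w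
  have hA1 : diffOp L R c A = 0 := by
    rw [diffOp_apply, hA', D_add, D_real_smul, D_real_smul, hA', hB', hR, hc]
    module
  have hB1 : diffOp L R c B = 0 := by
    rw [diffOp_apply, hB', D_add, D_real_smul, D_real_smul, hA', hB', hR, hc]
    module
  simp only [← diffOp_apply] at hP ⊢
  set g := -(P.eval 0 • A) - ((a / w) • P.eval 0 + (1 / w) • P.D.eval 0) • B + P with hg
  have h1 : diffOp L R c g = F := by
    rw [hg, map_add, map_sub, map_neg, map_smul, map_smul, hA1, hB1, hP]
    simp
  have h2 : g.eval 0 = 0 := by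
    rw [hg, map_add, map_sub, map_neg, eval_smul, eval_smul, hA0, hB0]
    ring
  -- At 0 the cosine has derivative -a and the sine has derivative w. The coefficient of the sine is
  -- therefore (a P(0) + P'(0))/w, which cancels both P'(0) and the contribution a P(0) of the
  -- cosine term.
  have h3 : g.D.eval 0 = 0 := by
    rw [hg, D_add, D_sub, D_neg, D_smul, D_smul, hA', hB', map_add, map_sub, map_neg, eval_smul,
      eval_smul, map_add, map_add, eval_real_smul, eval_real_smul, eval_real_smul, eval_real_smul,
      hA0, hB0, smul_zero, smul_zero, add_zero, zero_add, mul_smul_comm, mul_smul_comm, mul_one,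
      mul_one, smul_add, smul_smul, smul_smul, mul_div_cancel₀ _ hw, mul_one_div_cancel hw]
    module
  refine ⟨fun ⟨h4, h5, h6⟩ => ?_, fun h => h ▸ ⟨h1, h2, h3⟩⟩
  refine sub_eq_zero.1 (eq_zero_of_second_order hL (b := R) (c := c) ?_ ?_ ?_)
  · rw [← diffOp_apply, map_sub, h4, h1, sub_self]
  · rw [map_sub, h5, h2, sub_self]
  · rw [D_sub, map_sub, h6, h3, sub_self]

/-- Turns the condition L I'(0) = 0 into I'(0) = 0 when L ≠ 0. -/
theorem real_smul_genNum_eq_zero_iff {L : ℝ} (hL : L ≠ 0) (x : GenNum U) : L • x = 0 ↔ x = 0 := by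
  refine ⟨fun h => ?_, fun h => by rw [h, smul_zero]⟩
  rw [← inv_smul_smul₀ hL x, h, smul_zero]

theorem lineDeriv_add (T S : Dist) : ∂_{(1 : ℝ)} (T + S) = ∂_{(1 : ℝ)} T + ∂_{(1 : ℝ)} S :=
  LineDeriv.lineDerivOp_add _ _ _

theorem lineDeriv_smul (c : ℝ) (T : Dist) : ∂_{(1 : ℝ)} (c • T) = c • ∂_{(1 : ℝ)} T :=
  LineDeriv.lineDerivOp_smul _ _ _

/-- The convolution with a fundamental solution of a second order operator is a particular
solution. -/
theorem second_order_spanConv {L R c : ℝ} {G : Dist} (hG : G ∈ dPlus)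
    (h : L • ∂_{(1 : ℝ)} (∂_{(1 : ℝ)} G) + R • ∂_{(1 : ℝ)} G + c • G = diracDelta)
    {F : GenFun U} (hF : F ∈ spanHat U dPlus) :
    L • (spanConv G F).D.D + R • (spanConv G F).D + c • spanConv G F = F := by
  rw [D_spanConv hG hF, D_spanConv (lineDeriv_mem_dPlus hG) hF, ← spanConv_smul_left _ _ hF,
    ← spanConv_smul_left _ _ hF, ← spanConv_smul_left _ _ hF, ← spanConv_add_left _ _ hF,
    ← spanConv_add_left _ _ hF, h, spanConv_diracDelta hF]

theorem first_order_spanConv {b c : ℝ} {g : Dist} (hg : g ∈ dPlus)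
    (h : b • ∂_{(1 : ℝ)} g + c • g = diracDelta) {F : GenFun U} (hF : F ∈ spanHat U dPlus) :
    b • (spanConv g F).D + c • spanConv g F = F := by
  rw [D_spanConv hg hF, ← spanConv_smul_left _ _ hF, ← spanConv_smul_left _ _ hF,
    ← spanConv_add_left _ _ hF, h, spanConv_diracDelta hF]

/-- The first derivative contains w times the causal cosine, whose unit jump produces the mass w δ
in the second. -/
theorem lineDeriv_lineDeriv_causalSin (a w : ℝ) :
    ∂_{(1 : ℝ)} (∂_{(1 : ℝ)} (causalSin a w)) =
      w • diracDelta + (a ^ 2 - w ^ 2) • causalSin a w + (-2 * a * w) • causalCos a w := by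
  rw [lineDeriv_causalSin, lineDeriv_add, lineDeriv_smul, lineDeriv_smul, lineDeriv_causalSin,
    lineDeriv_causalCos]
  module

/-- With a = 1/(RC), the kernel (1/R) H(t) e^(-a t) is a fundamental solution of R d/dt + 1/C, and
e^(-a t) is the homogeneous solution with value 1 at 0. -/
theorem resistive_current {R C : ℝ} (hR : 0 < R) (hC : 0 < C) {V : GenFun U}
    (hV : V ∈ spanHat U dPlus) (f : GenFun U) :
    (R • f.D + (1 / C) • f = V.D ∧ f.eval 0 = 0) ↔
      f = spanConv (regular fun t => 1 / R * step t * Real.exp (-(t / (R * C)))) V.D -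
        (spanConv (regular fun t => 1 / R * step t * Real.exp (-(t / (R * C)))) V.D).eval 0 •
          ι U (regular fun t => Real.exp (-(t / (R * C)))) := by
  have hF := D_mem_spanHat hV
  set a : ℝ := 1 / (R * C) with ha
  have e0 : ∀ t : ℝ, -(t / (R * C)) = -(a * t) := fun t => by rw [ha]; ring
  have hcont : Continuous fun t => Real.exp (-(a * t)) := by fun_prop
  have e1 : (regular fun t => 1 / R * step t * Real.exp (-(t / (R * C)))) =
      (1 / R) • regular fun t => step t * Real.exp (-(a * t)) := by
    rw [← regular_const_mul _ (locallyIntegrable_step_mul hcont)]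
    simp only [e0, mul_assoc]
  rw [e1]
  simp only [e0]
  have hRa : R * a = 1 / C := by rw [ha]; field_simp
  have d1 : ∂_{(1 : ℝ)} (regular fun t => step t * Real.exp (-(a * t))) =
      diracDelta + -a • regular fun t => step t * Real.exp (-(a * t)) := by
    rw [lineDeriv_regular_step (hasDerivAt_exp_neg_mul a) (by fun_prop),
      ← regular_const_mul _ (locallyIntegrable_step_mul hcont)]
    simp only [mul_left_comm, mul_zero, neg_zero, Real.exp_zero]
    congr 1
    exact one_smul ℝ diracDelta
  have d2 : ∂_{(1 : ℝ)} (regular fun t => Real.exp (-(a * t))) =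
      -a • regular fun t => Real.exp (-(a * t)) := by
    rw [lineDeriv_regular (hasDerivAt_exp_neg_mul a) (by fun_prop),
      ← regular_const_mul _ hcont.locallyIntegrable]
  refine first_order_solution_iff hR.ne' (first_order_spanConv
    (smul_mem_dPlus _ (regular_step_mem_dPlus hcont)) ?_ hF) ?_ ?_ f
  · rw [lineDeriv_smul, d1, smul_smul, mul_one_div_cancel hR.ne', ← hRa, smul_smul,
      show R * a * (1 / R) = a by field_simp]
    module
  · rw [D_ι, d2, ι_smul, smul_smul, ← hRa]
    module
  · rw [← map_one (algebraMap ℝ (GenNum U))]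
    refine eval_ι_regular_eq hcont.locallyIntegrable ?_
    simpa only [neg_mul] using isNegligibleNum_exp (-a)

end

end SteadyState

/-! ### The three circuits. -/

theorem mainTheorem6 (U : SteadyState.DirectingUltrafilter) (L R C : ℝ)
    (hL : 0 ≤ L) (hR : 0 ≤ R) (hC : 0 < C) (hLR : L ^ 2 + R ^ 2 ≠ 0)
    (V : SteadyState.GenFun U) (hV : V ∈ SteadyState.spanHat U SteadyState.dPlus) :
    (L = 0 → ∀ g : SteadyState.Dist,
      g = SteadyState.regular
        (fun t => 1 / R * SteadyState.step t * Real.exp (-(t / (R * C)))) →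
      ∀ I : SteadyState.GenFun U,
        (SteadyState.IsCurrent L R C V I ↔
          R • I.D + (1 / C) • I = V.D ∧ I.eval 0 = 0) ∧
        (SteadyState.IsCurrent L R C V I ↔
          I = SteadyState.spanConv g V.D -
            (SteadyState.spanConv g V.D).eval 0 •
              SteadyState.ι U (SteadyState.regular fun t => Real.exp (-(t / (R * C)))))) ∧
    (R ^ 2 - 4 * L / C < 0 → ∀ (w : ℝ) (G : SteadyState.Dist),
      w = 1 / (2 * L) * √(4 * L / C - R ^ 2) →
      G = SteadyState.regular (fun t =>
        1 / (L * w) * SteadyState.step t * Real.exp (-(R / (2 * L) * t)) * Real.sin (w * t)) →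
      (∀ I : SteadyState.GenFun U,
        (SteadyState.IsCurrent L R C V I ↔
          L • I.D.D + R • I.D + (1 / C) • I = V.D ∧ I.eval 0 = 0 ∧ I.D.eval 0 = 0) ∧
        (SteadyState.IsCurrent L R C V I ↔
          I = -((SteadyState.spanConv G V.D).eval 0 •
                SteadyState.ι U (SteadyState.regular fun t =>
                  Real.exp (-(R / (2 * L) * t)) * Real.cos (w * t))) -
              ((1 / (2 * L * w)) • (R • (SteadyState.spanConv G V.D).eval 0 +
                  (2 * L) • (SteadyState.spanConv (∂_{(1 : ℝ)} G) V.D).eval 0)) •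
                SteadyState.ι U (SteadyState.regular fun t =>
                  Real.exp (-(R / (2 * L) * t)) * Real.sin (w * t)) +
              SteadyState.spanConv G V.D)) ∧
      SteadyState.InfClose ((SteadyState.ι U G).eval 0) 0 ∧
      SteadyState.InfClose ((SteadyState.ι U (∂_{(1 : ℝ)} G)).eval 0)
        (algebraMap ℝ (SteadyState.GenNum U) (1 / (2 * L))) ∧
      ∂_{(1 : ℝ)} G = -(R / (2 * L)) • G + (1 / L) • SteadyState.regular (fun t =>
        SteadyState.step t * Real.exp (-(R / (2 * L) * t)) * Real.cos (w * t)) ∧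
      ∂_{(1 : ℝ)} (∂_{(1 : ℝ)} G) = (1 / L) • SteadyState.diracDelta -
        (R / L) • ∂_{(1 : ℝ)} G - (1 / (L * C)) • G ∧
      ∂_{(1 : ℝ)} (∂_{(1 : ℝ)} G) = (1 / L) • SteadyState.diracDelta -
        (R / L ^ 2) • SteadyState.regular (fun t =>
          SteadyState.step t * Real.exp (-(R / (2 * L) * t)) * Real.cos (w * t)) +
        (1 / (L * w) * (R ^ 2 / (4 * L ^ 2) - w ^ 2)) • SteadyState.regular (fun t =>
          SteadyState.step t * Real.exp (-(R / (2 * L) * t)) * Real.sin (w * t))) ∧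
    (R = 0 → 0 < L → ∀ (w : ℝ) (G₀ : SteadyState.Dist),
      w = 1 / √(L * C) →
      G₀ = SteadyState.regular (fun t => 1 / w * SteadyState.step t * Real.sin (w * t)) →
      (∀ I : SteadyState.GenFun U,
        (SteadyState.IsCurrent L R C V I ↔
          L • I.D.D + (1 / C) • I = V.D ∧ I.eval 0 = 0 ∧ I.D.eval 0 = 0) ∧
        (SteadyState.IsCurrent L R C V I ↔
          I = -(((1 / L) • (SteadyState.spanConv G₀ V.D).eval 0) •
                SteadyState.ι U (SteadyState.regular fun t => Real.cos (w * t))) -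
              ((1 / (L * w)) • (SteadyState.spanConv (∂_{(1 : ℝ)} G₀) V.D).eval 0) •
                SteadyState.ι U (SteadyState.regular fun t => Real.sin (w * t)) +
              (1 / L) • SteadyState.spanConv G₀ V.D)) ∧
      SteadyState.InfClose ((SteadyState.ι U G₀).eval 0) 0 ∧
      (SteadyState.ι U (∂_{(1 : ℝ)} G₀)).eval 0 =
        algebraMap ℝ (SteadyState.GenNum U) (1 / 2) ∧
      ∂_{(1 : ℝ)} G₀ = SteadyState.regular (fun t => SteadyState.step t * Real.cos (w * t)) ∧
      ∂_{(1 : ℝ)} (∂_{(1 : ℝ)} G₀) = SteadyState.diracDelta - w ^ 2 • G₀ ∧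
      ∂_{(1 : ℝ)} (∂_{(1 : ℝ)} G₀) = SteadyState.diracDelta -
        w • SteadyState.regular (fun t => SteadyState.step t * Real.sin (w * t))) := by
  -- The convolutions are taken with V', so the span must be stable under differentiation.
  have hF := SteadyState.D_mem_spanHat hV
  refine ⟨?_, ?_, ?_⟩
  · rintro rfl g rfl I
    have hR0 : 0 < R := lt_of_le_of_ne hR fun h => hLR (by rw [← h]; norm_num)
    have h1 : SteadyState.IsCurrent 0 R C V I ↔
        R • I.D + (1 / C) • I = V.D ∧ I.eval 0 = 0 := by
      simp only [SteadyState.IsCurrent, zero_smul, zero_add, and_true]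
    exact ⟨h1, h1.trans (SteadyState.resistive_current hR0 hC hV I)⟩
  · rintro hdisc w G hw hG
    have hL0 : 0 < L := lt_of_le_of_ne hL fun h => by
      rw [← h] at hdisc
      simp only [mul_zero, zero_div, sub_zero] at hdisc
      exact absurd (sq_nonneg R) (not_le.2 hdisc)
    have hL' := hL0.ne'
    have hC' := hC.ne'
    have hw0 : 0 < w := by
      rw [hw]
      have : 0 < √(4 * L / C - R ^ 2) := Real.sqrt_pos.2 (by linarith)
      positivity
    have hw' := hw0.ne'
    -- Equivalently, -R/(2L) ± i w are the characteristic roots of the equation.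
    have hw2 : w ^ 2 = 1 / (L * C) - (R / (2 * L)) ^ 2 := by
      rw [hw, mul_pow, Real.sq_sqrt (by linarith)]
      field_simp
      ring
    have hG1 : G = (1 / (L * w)) • SteadyState.causalSin (R / (2 * L)) w := by
      rw [hG, SteadyState.causalSin_eq, ← SteadyState.regular_const_mul _
        (SteadyState.locallyIntegrable_step_mul (SteadyState.continuous_exp_mul_sin _ _))]
      simp only [mul_assoc]
    have hG' : ∂_{(1 : ℝ)} G = -(R / (2 * L)) • G +
        (1 / L) • SteadyState.causalCos (R / (2 * L)) w := by
      rw [hG1, SteadyState.lineDeriv_smul, SteadyState.lineDeriv_causalSin]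
      match_scalars <;> field_simp
    have hG'' : ∂_{(1 : ℝ)} (∂_{(1 : ℝ)} G) = (1 / L) • SteadyState.diracDelta -
        (R / L ^ 2) • SteadyState.causalCos (R / (2 * L)) w +
        (1 / (L * w) * (R ^ 2 / (4 * L ^ 2) - w ^ 2)) •
          SteadyState.causalSin (R / (2 * L)) w := by
      rw [hG1, SteadyState.lineDeriv_smul, SteadyState.lineDeriv_smul,
        SteadyState.lineDeriv_lineDeriv_causalSin]
      match_scalars <;> field_simp
      ring
    have hG2 : ∂_{(1 : ℝ)} (∂_{(1 : ℝ)} G) = (1 / L) • SteadyState.diracDelta -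
        (R / L) • ∂_{(1 : ℝ)} G - (1 / (L * C)) • G := by
      have : 1 / (L * C) = w ^ 2 + (R / (2 * L)) ^ 2 := by rw [hw2]; ring
      rw [hG'', hG', this, hG1]
      match_scalars <;> field_simp
      ring
    have hGm : G ∈ SteadyState.dPlus := by
      rw [hG1]
      exact SteadyState.smul_mem_dPlus _ (SteadyState.causalSin_mem_dPlus _ _)
    refine ⟨fun I => ?_, ?_, ?_, hG', hG2, hG''⟩
    · have h1 : SteadyState.IsCurrent L R C V I ↔
          L • I.D.D + R • I.D + (1 / C) • I = V.D ∧ I.eval 0 = 0 ∧ I.D.eval 0 = 0 := by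
        rw [SteadyState.IsCurrent, SteadyState.real_smul_genNum_eq_zero_iff hL']
      refine ⟨h1, h1.trans ?_⟩
      -- The general coefficients a/w and 1/w are brought over the common denominator 2 L w, and the
      -- derivative of G ⋆ V' is rewritten as G' ⋆ V'.
      rw [SteadyState.second_order_solution_iff (a := R / (2 * L)) (w := w) hL' hw'
        (by field_simp) (by rw [hw2]; field_simp; ring)
        (SteadyState.second_order_spanConv hGm (R := R) (c := 1 / C) (L := L) ?_ hF),
        SteadyState.D_spanConv hGm hF, smul_add, smul_smul, smul_smul,
        show R / (2 * L) / w = 1 / (2 * L * w) * R by field_simp,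
        show 1 / w = 1 / (2 * L * w) * (2 * L) by field_simp]
      · rfl
      · rw [hG2]
        match_scalars <;> field_simp <;> ring
    · rw [hG1]
      exact SteadyState.infClose_causalSin _ _ _
    -- G' jumps by 1/L at the origin, and its value there is infinitely close to half of the jump.
    · rw [hG', hG1, smul_smul, show 1 / (2 * L) = 1 / L / 2 by field_simp]
      exact SteadyState.infClose_combination _ _ _ _
  · rintro rfl hL0 w G hw hG
    have hL' := hL0.ne'
    have hC' := hC.ne'
    have hw0 : 0 < w := by rw [hw]; positivity
    have hw' := hw0.ne'
    have hw2 : w ^ 2 = 1 / (L * C) := by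
      rw [hw, div_pow, one_pow, Real.sq_sqrt (by positivity)]
    have hs : SteadyState.causalSin 0 w =
        SteadyState.regular fun t => SteadyState.step t * Real.sin (w * t) := by
      simp [SteadyState.causalSin]
    have hc : SteadyState.causalCos 0 w =
        SteadyState.regular fun t => SteadyState.step t * Real.cos (w * t) := by
      simp [SteadyState.causalCos]
    have hds : SteadyState.dampedSin 0 w = SteadyState.regular fun t => Real.sin (w * t) := by
      simp [SteadyState.dampedSin]
    have hdc : SteadyState.dampedCos 0 w = SteadyState.regular fun t => Real.cos (w * t) := by
      simp [SteadyState.dampedCos]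
    have hG1 : G = (1 / w) • SteadyState.causalSin 0 w := by
      rw [hG, hs, ← SteadyState.regular_const_mul _
        (SteadyState.locallyIntegrable_step_mul (by fun_prop))]
      simp only [mul_assoc]
    have hG' : ∂_{(1 : ℝ)} G = SteadyState.causalCos 0 w := by
      rw [hG1, SteadyState.lineDeriv_smul, SteadyState.lineDeriv_causalSin]
      match_scalars <;> field_simp
      ring
    have hG'' : ∂_{(1 : ℝ)} (∂_{(1 : ℝ)} G) = SteadyState.diracDelta -
        w • SteadyState.causalSin 0 w := by
      rw [hG', SteadyState.lineDeriv_causalCos]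
      module
    have hG2 : ∂_{(1 : ℝ)} (∂_{(1 : ℝ)} G) = SteadyState.diracDelta - w ^ 2 • G := by
      rw [hG'', hG1]
      match_scalars <;> field_simp
    have hGm : G ∈ SteadyState.dPlus := by
      rw [hG1]
      exact SteadyState.smul_mem_dPlus _ (SteadyState.causalSin_mem_dPlus _ _)
    refine ⟨fun I => ?_, ?_, ?_, hc ▸ hG', hG2, hs ▸ hG''⟩
    · have h1 : SteadyState.IsCurrent L 0 C V I ↔
          L • I.D.D + (1 / C) • I = V.D ∧ I.eval 0 = 0 ∧ I.D.eval 0 = 0 := by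
        rw [SteadyState.IsCurrent, SteadyState.real_smul_genNum_eq_zero_iff hL', zero_smul,
          add_zero]
      have h2 : ((1 / L : ℝ) • SteadyState.spanConv G V.D).D =
          (1 / L : ℝ) • SteadyState.spanConv (∂_{(1 : ℝ)} G) V.D := by
        rw [SteadyState.D_real_smul, SteadyState.D_spanConv hGm hF]
      -- `G` is a fundamental solution of d²/dt² + w². Since w² = 1/(LC), the rescaled kernel G/L is
      -- one for L d²/dt² + 1/C; this is why 1/L appears in front of every term.
      have h3 := SteadyState.second_order_solution_iff (a := 0) (w := w) (R := 0)
        (c := 1 / C) (L := L) (F := V.D) (P := (1 / L : ℝ) • SteadyState.spanConv G V.D)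
        hL' hw' (by ring) (by rw [zero_pow two_ne_zero, zero_add, hw2]; field_simp) (by
          rw [← SteadyState.spanConv_smul_left _ _ hF]
          refine SteadyState.second_order_spanConv (SteadyState.smul_mem_dPlus _ hGm) ?_ hF
          rw [SteadyState.lineDeriv_smul, SteadyState.lineDeriv_smul, hG2, hw2]
          match_scalars <;> field_simp <;> ring) I
      refine ⟨h1, ?_⟩
      rw [SteadyState.IsCurrent, SteadyState.real_smul_genNum_eq_zero_iff hL', h3, h2,
        SteadyState.eval_real_smul, SteadyState.eval_real_smul, hdc, hds, zero_div, zero_smul,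
        zero_add, smul_smul, show 1 / w * (1 / L) = 1 / (L * w) by field_simp]
    · rw [hG1]
      exact SteadyState.infClose_causalSin _ _ _
    · rw [hG', hc]
      -- Without damping the smooth factor is the even function cos(w t), so the value is exactly
      -- one half.
      refine SteadyState.eval_ι_regular_step_even (by fun_prop) (fun x => by simp) ?_
      simpa using SteadyState.isNegligibleNum_exp_mul_cos (U := U) 0 w
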